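/- Let $K$ be a field of characteristic $0$. For a set $X$ let $K\{X\}$ be the free (non-associative) $K$-algebra with unit on $X$; its vector space basis is the set of planar binary trees with leaves labelled by $X$, including the empty tree $1$, multiplied by grafting. The co-addition $\Delta: K\{X\}\to K\{X\}\otimes K\{X\}$ is the homomorphism of algebras with unit given by $x\mapsto x\otimes 1+1\otimes x$ for $x\in X$, and $f$ is called primitive if $\Delta(f)=f\otimes 1+1\otimes f$. Let $A_0=\ker\frac{d}{dx}\subset K\{x\}$ be the algebra of constants of the derivation $\frac{d}{dx}$ of $K\{x\}$ with $\frac{d}{dx}x=1$. By a graded free generating sequence of $A_0$ we mean a sequence $y_1,y_2,\dots$ of elements of $A_0$, with $y_i$ homogeneous of degree $d_i$ in $K\{x\}$ and $d_i\le d_{i+1}$ for all $i$, such that the homomorphism of algebras with unit $\varepsilon_y: K\{Y\}\to K\{x\}$, $Y=\{Y_1,Y_2,\dots\}$, $Y_i\mapsto y_i$, is injective with image $A_0$. Theorem. (1) There is a graded free generating sequence of $A_0$ with $d_1=3$. (2) Let $(y_i)$ be any graded free generating sequence of $A_0$. Then $\Delta|_{A_0}$ defines a homomorphism on $K\{Y\}$: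 there is a unique algebra homomorphism $\Delta': K\{Y\}\to K\{Y\}\otimes K\{Y\}$ with $(\varepsilon_y\otimes\varepsilon_y)\circ\Delta'=\Delta\circ\varepsilon_y$. Moreover, there is an automorphism $\varphi$ of the algebra with unit $K\{Y\}$ such that $\Delta=(\varphi\otimes\varphi)\circ\Delta'\circ\varphi^{-1}$, where $\Delta$ is the co-addition of $K\{Y\}$, and which is strict: for every $i$, all terms of $\varphi(Y_i)-Y_i$ have degree at least $2$ in the variables $Y_1,Y_2,\dots$ (each of degree $1$). (3) Hence there is a graded free generating sequence of $A_0$ with $d_1=3$ that consists of primitive elements of $K\{x\}$. -/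

import Mathlib

open scoped TensorProduct

/-- The planar binary trees with leaves labelled by `X`, including the empty tree `1`. -/
abbrev Tree₁ (X : Type*) := WithOne (FreeMagma X)

/-- The free magma algebra with unit `K{X}`: it has the trees as a vector space basis, and the
product is the bilinear extension of the grafting of trees. -/
abbrev MagAlg (K X : Type*) [Field K] := MonoidAlgebra K (Tree₁ X)

namespace MagAlg

section General

variable {K X : Type*} [Field K]

/-- The number of leaves of a tree (`0` for the empty tree). -/
def deg (t : Tree₁ X) : ℕ := WithOne.recOneCoe 0 FreeMagma.length t

/-- A tree, as a basis element of `K{X}`. -/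
noncomputable def mon (K : Type*) [Field K] (t : Tree₁ X) : MagAlg K X :=
  MonoidAlgebra.single t 1

/-- The variable `x`, as an element of `K{X}`. -/
noncomputable def var (K : Type*) [Field K] (x : X) : MagAlg K X :=
  mon K (FreeMagma.of x : Tree₁ X)

/-- `f` is homogeneous of degree `n` (every variable has degree `1`). -/
def IsHomogeneous (f : MagAlg K X) (n : ℕ) : Prop :=
  ∀ t : Tree₁ X, f.coeff t ≠ 0 → deg t = n

section Lift

variable {B : Type*} [NonAssocSemiring B] [Module K B] [IsScalarTower K B B] [SMulCommClass K B B]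

/-- The homomorphism of algebras with unit `K{X} → B` that maps the variable `x` to `f x`. -/
noncomputable def lift (f : X → B) : MagAlg K X →ₙₐ[K] B :=
  MonoidAlgebra.liftMagma K (WithOne.lift (FreeMagma.lift f) : Tree₁ X →* B)

theorem lift_one (f : X → B) : lift (K := K) f 1 = 1 := by
  simp [lift, MonoidAlgebra.one_def]

theorem lift_var (f : X → B) (x : X) : lift f (var K x) = f x := by
  simp [lift, var, mon]

end Lift

/-- The co-addition: the homomorphism of algebras with unit `K{X} → K{X} ⊗ K{X}` with
`x ↦ x ⊗ 1 + 1 ⊗ x` for every variable `x`. -/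
noncomputable def coadd (K X : Type*) [Field K] : MagAlg K X →ₙₐ[K] MagAlg K X ⊗[K] MagAlg K X :=
  lift fun x => var K x ⊗ₜ[K] 1 + 1 ⊗ₜ[K] var K x

/-- Primitive elements for the co-addition. -/
def IsPrimitive (f : MagAlg K X) : Prop :=
  coadd K X f = f ⊗ₜ[K] 1 + 1 ⊗ₜ[K] f

/-- A linear endomorphism `φ` of `K{X}` is strict if, for every variable `x`, `φ x - x` has
only terms of degree at least `2`: the linear part of `φ` is the identity. -/
def IsStrict (φ : MagAlg K X →ₗ[K] MagAlg K X) : Prop :=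
  ∀ (x : X) (t : Tree₁ X), deg t ≤ 1 → (φ (var K x)).coeff t = (var K x).coeff t

end General

section OneVariable

variable {K : Type*} [Field K]

/-- The derivative of a nonempty tree in one variable, by the Leibniz rule. -/
noncomputable def derivTree (K : Type*) [Field K] : FreeMagma Unit → MagAlg K Unit
  | .of _ => 1
  | .mul s t => derivTree K s * mon K (t : Tree₁ Unit) + mon K (s : Tree₁ Unit) * derivTree K t

/-- The derivation `d/dx` of `K{x}`. -/
noncomputable def ddx (K : Type*) [Field K] : MagAlg K Unit →ₗ[K] MagAlg K Unit :=
  (Finsupp.linearCombination K (WithOne.recOneCoe 0 (derivTree K))) ∘ₗ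
    (MonoidAlgebra.coeffLinearEquiv K).toLinearMap

theorem ddx_mon (t : Tree₁ Unit) : ddx K (mon K t) = WithOne.recOneCoe 0 (derivTree K) t := by
  simp [ddx, mon]

theorem ddx_one : ddx K 1 = 0 := ddx_mon 1

theorem ddx_var : ddx K (var K ()) = 1 := ddx_mon _

theorem mon_mul (s t : Tree₁ Unit) : mon K s * mon K t = mon K (s * t) := by
  simp [mon, MonoidAlgebra.single_mul_single]

theorem ddx_mul (f g : MagAlg K Unit) : ddx K (f * g) = ddx K f * g + f * ddx K g := by
  have key : ∀ s t : Tree₁ Unit,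
      ddx K (mon K s * mon K t) = ddx K (mon K s) * mon K t + mon K s * ddx K (mon K t) := by
    intro s t
    induction s using WithOne.recOneCoe with
    | one => change ddx K (1 * _) = ddx K 1 * _ + 1 * _; simp [ddx_one]
    | coe s =>
      induction t using WithOne.recOneCoe with
      | one => change ddx K (_ * 1) = _ * 1 + _ * ddx K 1; simp [ddx_one]
      | coe t => rw [mon_mul, ← WithOne.coe_mul, ddx_mon, ddx_mon, ddx_mon]; rfl
  have single_eq : ∀ (t : Tree₁ Unit) (c : K), MonoidAlgebra.single t c = c • mon K t := by
    intro t c; simp [mon]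
  induction f using MonoidAlgebra.induction_linear with
  | zero => simp
  | add f₁ f₂ h₁ h₂ => simp only [add_mul, map_add, h₁, h₂]; abel
  | single s a =>
    induction g using MonoidAlgebra.induction_linear with
    | zero => simp
    | add g₁ g₂ h₁ h₂ => simp only [mul_add, map_add, h₁, h₂]; abel
    | single t b =>
      rw [single_eq, single_eq]
      simp only [smul_mul_assoc, mul_smul_comm, map_smul, key, smul_add]

/-- The algebra `A₀` of constants of `d/dx` in `K{x}` (it also contains `1`, by `ddx_one`). -/
noncomputable def constants (K : Type*) [Field K] : NonUnitalSubalgebra K (MagAlg K Unit) where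
  carrier := {f | ddx K f = 0}
  zero_mem' := map_zero _
  add_mem' {f g} hf hg := by
    simp only [Set.mem_ofPred_eq] at *; simp [hf, hg]
  mul_mem' {f g} hf hg := by
    simp only [Set.mem_ofPred_eq] at *; simp [ddx_mul, hf, hg]
  smul_mem' c f hf := by
    simp only [Set.mem_ofPred_eq] at *; simp [hf]

/-- The sequence `y` of elements of `K{x}` freely generates the algebra (with unit) `A₀`, i.e.
the substitution homomorphism `K{Y} → K{x}`, `Y = {Y₀, Y₁, …}`, `Yᵢ ↦ yᵢ`, is an isomorphism
onto `A₀`; moreover `yᵢ` is homogeneous of degree `dᵢ`, and the degrees are nondecreasing. -/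
structure IsGradedFreeGenSeq (y : ℕ → MagAlg K Unit) (d : ℕ → ℕ) : Prop where
  injective : Function.Injective (lift y : MagAlg K ℕ →ₙₐ[K] MagAlg K Unit)
  range_eq : Set.range (lift y : MagAlg K ℕ →ₙₐ[K] MagAlg K Unit) = constants K
  homogeneous : ∀ i, IsHomogeneous (y i) (d i)
  monotone : Monotone d

/-- `Δ' : K{Y} → K{Y} ⊗ K{Y}` is the restriction to `A₀` of the co-addition `Δ` of `K{x}`, read
through the substitution `ε : K{Y} → A₀ ⊆ K{x}`, `Yᵢ ↦ yᵢ`: `(ε ⊗ ε) ∘ Δ' = Δ ∘ ε`. -/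
def IsRestrictedCoadd (y : ℕ → MagAlg K Unit)
    (Δ' : MagAlg K ℕ →ₙₐ[K] MagAlg K ℕ ⊗[K] MagAlg K ℕ) : Prop :=
  ∀ f : MagAlg K ℕ,
    TensorProduct.map ((lift y : MagAlg K ℕ →ₙₐ[K] MagAlg K Unit) : MagAlg K ℕ →ₗ[K] MagAlg K Unit)
      ((lift y : MagAlg K ℕ →ₙₐ[K] MagAlg K Unit) : MagAlg K ℕ →ₗ[K] MagAlg K Unit) (Δ' f) = coadd K Unit (lift y f)

end OneVariable

end MagAlg

namespace MagAlg

/-! Free generators. The alternating Taylor sum `constProj` is a projection of K{x} onto A₀ whose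
kernel consists of the right multiples of x, so the images of the trees not of the form u * x form a
basis of A₀. Cutting a tree at its root and projecting both factors gives `constUngraft`, which
recovers f ⊗ g from a product f * g of constants without constant term. A constant without constant
term that it kills is a combination of the images of the trees in `IsGenTree`. These images generate
A₀ (`range_lift_constProj`), and recursion on the root shows that they do so freely
(`lift_constProj_injective`).

Restricting Δ. The co-addition commutes with d/dx in either tensor factor, hence maps A₀ into the
intersection of the two kernels, which is A₀ ⊗ A₀ over a field.

Primitive generators. Let Ψ be Δ followed by multiplication (`square`). Although the product is not
associative, Δ intertwines Ψ with Ψ ⊗ Ψ, because the iterated co-addition is invariant under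
exchanging the middle factors. Primitive elements have eigenvalue 2, and in degree n all eigenvalues
are among 2, 4, …, 2ⁿ. A polynomial p in Ψ with p(2) = 1 that vanishes at the other ones therefore
maps everything of degree n to primitive elements (`isPrimitive_eulerPoly_and_mem_span`).

The automorphism. Ψ preserves A₀, and in K{Y} it doubles linear parts, so p(Ψ) Yᵢ has linear part Yᵢ
and becomes primitive in K{x}. A substitution with such linear parts is injective by looking at
lowest terms, and surjective because it respects the grading in which Yᵢ has weight dᵢ. Its inverse
is φ. -/

theorem mul_mem_of_mem_span {K B : Type*} [Field K] [NonUnitalNonAssocSemiring B] [Module K B]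
    [IsScalarTower K B B] [SMulCommClass K B B] {S T : Set B} {N : Submodule K B}
    (h : ∀ x ∈ S, ∀ y ∈ T, x * y ∈ N) {x y : B} (hx : x ∈ Submodule.span K S)
    (hy : y ∈ Submodule.span K T) : x * y ∈ N := by
  have h1 : ∀ x ∈ S, x * y ∈ N := fun x hx =>
    (Submodule.span_le (p := N.comap (LinearMap.mulLeft K x))).2 (h x hx) hy
  exact (Submodule.span_le (p := N.comap (LinearMap.mulRight K y))).2 h1 hx

theorem tensorMap_mul {K A B A' B' : Type*} [Field K]
    [NonUnitalNonAssocSemiring A] [Module K A] [IsScalarTower K A A] [SMulCommClass K A A]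
    [NonUnitalNonAssocSemiring B] [Module K B] [IsScalarTower K B B] [SMulCommClass K B B]
    [NonUnitalNonAssocSemiring A'] [Module K A'] [IsScalarTower K A' A'] [SMulCommClass K A' A']
    [NonUnitalNonAssocSemiring B'] [Module K B'] [IsScalarTower K B' B'] [SMulCommClass K B' B']
    {f : A →ₗ[K] A'} {g : B →ₗ[K] B'} (hf : ∀ a b, f (a * b) = f a * f b)
    (hg : ∀ a b, g (a * b) = g a * g b) (x y : A ⊗[K] B) :
    TensorProduct.map f g (x * y) = TensorProduct.map f g x * TensorProduct.map f g y := by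
  induction x using TensorProduct.induction_on with
  | zero => simp
  | add x₁ x₂ h₁ h₂ => simp only [add_mul, map_add, h₁, h₂]
  | tmul a b =>
    induction y using TensorProduct.induction_on with
    | zero => simp
    | add x₁ x₂ h₁ h₂ => simp only [mul_add, map_add, h₁, h₂]
    | tmul c d => simp [Algebra.TensorProduct.tmul_mul_tmul, hf, hg]

/-! ### Trees, coefficients and degrees -/

section Basics

variable {K X : Type*} [Field K]

theorem tree_induction {P : Tree₁ X → Prop} (one : P 1)
    (of : ∀ x, P (FreeMagma.of x : FreeMagma X))
    (mul : ∀ s t : FreeMagma X, P s → P t → P (s * t)) (t : Tree₁ X) : P t := by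
  induction t using WithOne.recOneCoe with
  | one => exact one
  | coe t =>
    induction t using FreeMagma.recOnMul with
    | ih1 x => exact of x
    | ih2 s t hs ht => exact mul s t hs ht

theorem mon_one : mon K (1 : Tree₁ X) = 1 := rfl

theorem mon_mul_mon (s t : Tree₁ X) : mon K s * mon K t = mon K (s * t) := by
  simp [mon, MonoidAlgebra.single_mul_single]

/-- The trees, as a basis of `K{X}`. -/
noncomputable def monBasis (K X : Type*) [Field K] : Module.Basis (Tree₁ X) K (MagAlg K X) :=
  ⟨MonoidAlgebra.coeffLinearEquiv K⟩

theorem coeff_mon [DecidableEq (Tree₁ X)] (s t : Tree₁ X) :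
    (mon K s).coeff t = if s = t then 1 else 0 := by
  simp [mon, Finsupp.single_apply]

/-- The coefficient of a tree, as a linear form. -/
noncomputable def coeffAt (K : Type*) [Field K] (t : Tree₁ X) : MagAlg K X →ₗ[K] K :=
  (monBasis K X).coord t

@[simp] theorem coeffAt_apply (t : Tree₁ X) (f : MagAlg K X) : coeffAt K t f = f.coeff t := rfl

/-- The linear combinations of the trees in a set. -/
noncomputable def treeSpan (K : Type*) [Field K] (S : Set (Tree₁ X)) : Submodule K (MagAlg K X) :=
  Submodule.span K (mon K '' S)

theorem mem_treeSpan {S : Set (Tree₁ X)} {f : MagAlg K X} :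
    f ∈ treeSpan K S ↔ ∀ t, f.coeff t ≠ 0 → t ∈ S := by
  change f ∈ Submodule.span K (monBasis K X '' S) ↔ _
  rw [Module.Basis.mem_span_image]
  simp only [Set.subset_def, Finset.mem_coe, Finsupp.mem_support_iff]
  rfl

theorem mon_mem_treeSpan {S : Set (Tree₁ X)} {t : Tree₁ X} (h : t ∈ S) :
    mon K t ∈ treeSpan K S := Submodule.subset_span ⟨t, h, rfl⟩

theorem mem_treeSpan_univ (f : MagAlg K X) : f ∈ treeSpan K (Set.univ : Set (Tree₁ X)) :=
  mem_treeSpan.2 fun _ _ => trivial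

theorem treeSpan_mono {S T : Set (Tree₁ X)} (h : S ⊆ T) : treeSpan K S ≤ treeSpan K T :=
  Submodule.span_mono (Set.image_mono h)

theorem map_mem_of_mem_treeSpan {V : Type*} [AddCommGroup V] [Module K V] {S : Set (Tree₁ X)}
    {N : Submodule K V} {L : MagAlg K X →ₗ[K] V} (h : ∀ t ∈ S, L (mon K t) ∈ N) {f : MagAlg K X}
    (hf : f ∈ treeSpan K S) : L f ∈ N := by
  refine (Submodule.span_le (p := N.comap L)).2 ?_ hf
  rintro _ ⟨t, ht, rfl⟩
  exact h t ht

theorem mul_mem_treeSpan {S T U : Set (Tree₁ X)} (h : ∀ s ∈ S, ∀ t ∈ T, s * t ∈ U)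
    {f g : MagAlg K X} (hf : f ∈ treeSpan K S) (hg : g ∈ treeSpan K T) :
    f * g ∈ treeSpan K U := by
  refine mul_mem_of_mem_span ?_ hf hg
  rintro _ ⟨s, hs, rfl⟩ _ ⟨t, ht, rfl⟩
  rw [mon_mul_mon]
  exact mon_mem_treeSpan (h s hs t ht)

theorem linearMap_ext_mon {V : Type*} [AddCommMonoid V] [Module K V] {f g : MagAlg K X →ₗ[K] V}
    (h : ∀ t, f (mon K t) = g (mon K t)) : f = g :=
  (monBasis K X).ext h

/-- Multiplicative linear maps with equal values at `1` and at the variables are equal. -/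
theorem linearMap_ext_of_mul {B : Type*} [NonUnitalNonAssocSemiring B] [Module K B]
    {f g : MagAlg K X →ₗ[K] B} (hf : ∀ a b, f (a * b) = f a * f b)
    (hg : ∀ a b, g (a * b) = g a * g b) (h1 : f 1 = g 1)
    (h : ∀ x, f (var K x) = g (var K x)) : f = g := by
  refine linearMap_ext_mon fun t => ?_
  induction t using tree_induction with
  | one => exact h1
  | of x => exact h x
  | mul s t hs ht => rw [← mon_mul_mon, hf, hg, hs, ht]

/-- The degree of a tree when the variables have the weights `w`. -/
noncomputable def wdeg (w : X → ℕ) (t : Tree₁ X) : ℕ :=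
  WithOne.recOneCoe 0 (FreeMagma.rec w fun _ _ a b => a + b) t

@[simp] theorem wdeg_one (w : X → ℕ) : wdeg w 1 = 0 := rfl

@[simp] theorem wdeg_of (w : X → ℕ) (x : X) :
    wdeg w ((FreeMagma.of x : FreeMagma X) : Tree₁ X) = w x := rfl

@[simp] theorem wdeg_mul (w : X → ℕ) (s t : Tree₁ X) : wdeg w (s * t) = wdeg w s + wdeg w t := by
  induction s using WithOne.recOneCoe with
  | one => simp
  | coe s =>
    induction t using WithOne.recOneCoe with
    | one => simp
    | coe t => rfl

theorem deg_eq_wdeg (t : Tree₁ X) : deg t = wdeg (fun _ => 1) t := by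
  induction t using tree_induction with
  | one => rfl
  | of x => rfl
  | mul s t hs ht => rw [wdeg_mul, ← hs, ← ht]; rfl

@[simp] theorem deg_one : deg (1 : Tree₁ X) = 0 := rfl

@[simp] theorem deg_of (x : X) : deg ((FreeMagma.of x : FreeMagma X) : Tree₁ X) = 1 := rfl

@[simp] theorem deg_mul (s t : Tree₁ X) : deg (s * t) = deg s + deg t := by
  simp [deg_eq_wdeg]

theorem deg_coe_pos (t : FreeMagma X) : 0 < deg (t : Tree₁ X) := by
  induction t using FreeMagma.recOnMul with
  | ih1 x => exact Nat.one_pos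
  | ih2 s t hs ht => rw [WithOne.coe_mul, deg_mul]; omega

theorem deg_eq_zero {t : Tree₁ X} : deg t = 0 ↔ t = 1 := by
  induction t using WithOne.recOneCoe with
  | one => simp
  | coe t => simpa using (deg_coe_pos t).ne'

theorem deg_le_one {t : Tree₁ X} (h : deg t ≤ 1) :
    t = 1 ∨ ∃ x : X, t = (FreeMagma.of x : FreeMagma X) := by
  induction t using tree_induction with
  | one => exact Or.inl rfl
  | of x => exact Or.inr ⟨x, rfl⟩
  | mul s t _ _ =>
    have := deg_coe_pos s
    have := deg_coe_pos t
    rw [deg_mul] at h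
    omega

theorem isHomogeneous_iff {f : MagAlg K X} {n : ℕ} :
    IsHomogeneous f n ↔ f ∈ treeSpan K {t | deg t = n} := mem_treeSpan.symm

theorem coeff_one_mul (f g : MagAlg K X) : (f * g).coeff 1 = f.coeff 1 * g.coeff 1 := by
  have key : ∀ s t : Tree₁ X,
      (mon K s * mon K t).coeff 1 = (mon K s).coeff 1 * (mon K t).coeff 1 := by
    intro s t
    classical
    rw [mon_mul_mon]
    simp only [coeff_mon, ← deg_eq_zero, deg_mul]
    split_ifs <;> simp_all
  have : (LinearMap.mul K (MagAlg K X)).compr₂ (coeffAt K 1)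
      = (LinearMap.mul K K).compl₁₂ (coeffAt K (1 : Tree₁ X)) (coeffAt K (1 : Tree₁ X)) :=
    (monBasis K X).ext fun s => (monBasis K X).ext fun t => key s t
  exact LinearMap.congr_fun (LinearMap.congr_fun this f) g

theorem lift_mul {B : Type*} [NonAssocSemiring B] [Module K B] [IsScalarTower K B B]
    [SMulCommClass K B B] (f : X → B) (a b : MagAlg K X) : lift f (a * b) = lift f a * lift f b :=
  map_mul _ a b

end Basics

/-! ### Polynomials in an operator with eigenvalues 2ᵏ -/

section Eigenvectors

open Polynomial

variable {K V W : Type*} [Field K] [AddCommGroup V] [Module K V] [AddCommGroup W] [Module K W]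

/-- Used to move polynomials in Ψ through the reduced co-addition, the substitution and the
coefficient forms. -/
theorem aeval_apply_of_intertwines {A : Module.End K V} {B : Module.End K W} {T : V →ₗ[K] W}
    (h : ∀ v, T (A v) = B (T v)) (p : K[X]) (v : V) : T (aeval A p v) = aeval B p (T v) := by
  induction p using Polynomial.induction_on' generalizing v with
  | add p q hp hq => simp [hp, hq]
  | monomial n a =>
    simp only [aeval_monomial, Module.End.mul_apply, Module.algebraMap_end_apply, map_smul]
    congr 1
    induction n generalizing v with
    | zero => rfl
    | succ n ih => rw [pow_succ, pow_succ, Module.End.mul_apply, Module.End.mul_apply, ih, h]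

theorem aeval_smul_id (μ : K) (p : K[X]) (v : V) :
    aeval (μ • (1 : Module.End K V)) p v = p.eval μ • v := by
  rw [← Algebra.algebraMap_eq_smul_one, aeval_algebraMap_apply]
  simp

theorem aeval_apply_of_eigenvector {A : Module.End K V} {v : V} {μ : K} (h : A v = μ • v)
    (p : K[X]) : aeval A p v = p.eval μ • v := by
  -- An eigenvector is a map K → V that intertwines the scalar μ with A.
  have := aeval_apply_of_intertwines (A := μ • (1 : Module.End K K)) (B := A)
    (T := LinearMap.toSpanSingleton K V v) (fun c => by
      simp [h, mul_smul, smul_comm μ c]) p 1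
  rw [aeval_smul_id] at this
  simpa using this.symm

/-- Linear factors with distinct roots are coprime, so the kernel of the product is the sum of the
kernels. -/
theorem mem_span_eigenvectors_of_aeval_prod_eq_zero {ι : Type*} [DecidableEq ι]
    {A : Module.End K V} {μ : ι → K} (hμ : Function.Injective μ) (s : Finset ι) {v : V}
    (h : aeval A (∏ i ∈ s, (X - C (μ i))) v = 0) :
    v ∈ Submodule.span K {v | ∃ i ∈ s, A v = μ i • v} := by
  induction s using Finset.induction_on generalizing v with
  | empty => simpa using h
  | insert i s hi ih =>
    have hc : IsCoprime (X - C (μ i)) (∏ i ∈ s, (X - C (μ i))) :=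
      IsCoprime.prod_right fun j hj => isCoprime_X_sub_C_of_isUnit_sub
        (sub_ne_zero.2 fun hij => hi (by rwa [hμ hij])).isUnit
    rw [Finset.prod_insert hi, ← LinearMap.mem_ker,
      ← sup_ker_aeval_eq_ker_aeval_mul_of_coprime A hc] at h
    obtain ⟨a, ha, b, hb, rfl⟩ := Submodule.mem_sup.1 h
    refine add_mem (Submodule.subset_span ⟨i, Finset.mem_insert_self _ _, ?_⟩)
      (Submodule.span_mono ?_ (ih hb))
    · simpa [sub_eq_zero] using ha
    · rintro w ⟨j, hj, hw⟩
      exact ⟨j, Finset.mem_insert_of_mem hj, hw⟩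

/-- The polynomial with the value `1` at `2` and the roots `2 ^ k`, `2 ≤ k ≤ n`. -/
noncomputable def eulerPoly (K : Type*) [Field K] (n : ℕ) : K[X] :=
  ∏ k ∈ Finset.Icc 2 n, C ((2 - 2 ^ k : K)⁻¹) * (X - C (2 ^ k))

theorem two_pow_injective [CharZero K] : Function.Injective fun k : ℕ => (2 : K) ^ k := by
  intro a b h
  have : ((2 ^ a : ℕ) : K) = ((2 ^ b : ℕ) : K) := by push_cast; exact h
  exact Nat.pow_right_injective le_rfl (Nat.cast_injective this)

theorem two_sub_two_pow_ne_zero [CharZero K] {k : ℕ} (hk : 2 ≤ k) : (2 - 2 ^ k : K) ≠ 0 := by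
  intro h
  have := two_pow_injective (K := K) (a₁ := 1) (a₂ := k) (by simpa using sub_eq_zero.1 h)
  omega

theorem eulerPoly_eval_two [CharZero K] (n : ℕ) : (eulerPoly K n).eval 2 = 1 := by
  rw [eulerPoly, eval_prod]
  refine Finset.prod_eq_one fun k hk => ?_
  simp [inv_mul_cancel₀ (two_sub_two_pow_ne_zero (K := K) (Finset.mem_Icc.1 hk).1)]

theorem eulerPoly_eval_two_pow {k n : ℕ} (h2 : 2 ≤ k) (hn : k ≤ n) :
    (eulerPoly K n).eval (2 ^ k) = 0 := by
  rw [eulerPoly, eval_prod]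
  exact Finset.prod_eq_zero (Finset.mem_Icc.2 ⟨h2, hn⟩) (by simp)

/-- If `p(A) v` is an eigenvector with the eigenvalue `2`, `p` the polynomial with the roots
`2 ^ k`, `2 ≤ k ≤ n`, then `v` is a sum of eigenvectors with eigenvalues `2 ^ k`, `1 ≤ k ≤ n`. -/
theorem mem_span_eigenvectors_of_eulerPoly [CharZero K] {A : Module.End K V} {v : V} {n : ℕ}
    (hn : 1 ≤ n) (h : A (aeval A (eulerPoly K n) v) = (2 : K) • aeval A (eulerPoly K n) v) :
    v ∈ Submodule.span K {v | ∃ k ∈ Finset.Icc 1 n, A v = (2 : K) ^ k • v} := by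
  refine mem_span_eigenvectors_of_aeval_prod_eq_zero two_pow_injective _ ?_
  -- The normalizing constant of `eulerPoly`; up to this nonzero scalar, (X - 2) p is the product
  -- over all the roots.
  set c : K := ∏ k ∈ Finset.Icc 2 n, (2 - 2 ^ k : K)⁻¹ with hc
  have hc0 : c ≠ 0 := Finset.prod_ne_zero_iff.2 fun k hk =>
    inv_ne_zero (two_sub_two_pow_ne_zero (Finset.mem_Icc.1 hk).1)
  have hI : Finset.Icc 1 n = insert 1 (Finset.Icc 2 n) := by
    ext k; simp only [Finset.mem_Icc, Finset.mem_insert]; omega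
  have hp : C c * ∏ k ∈ Finset.Icc 1 n, (X - C ((2 : K) ^ k)) = (X - C 2) * eulerPoly K n := by
    rw [hI, Finset.prod_insert (by simp), eulerPoly, Finset.prod_mul_distrib, hc, map_prod, pow_one]
    ring
  have h2 := congrArg (fun p => aeval A p v) hp
  simp only [map_mul, aeval_C, Module.End.mul_apply, Module.algebraMap_end_apply, map_sub, aeval_X,
    LinearMap.sub_apply, h, sub_self] at h2
  exact (smul_eq_zero.1 h2).resolve_left hc0

end Eigenvectors

/-! ### The convolution square and the projection to primitive elements -/

section Square

variable {K X : Type*} [Field K]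

theorem coadd_one : coadd K X 1 = 1 ⊗ₜ[K] 1 := lift_one _

theorem coadd_var (x : X) : coadd K X (var K x) = var K x ⊗ₜ[K] 1 + 1 ⊗ₜ[K] var K x := lift_var _ _

/-- The co-addition, as a linear map. -/
noncomputable def coaddLin (K X : Type*) [Field K] :
    MagAlg K X →ₗ[K] MagAlg K X ⊗[K] MagAlg K X :=
  coadd K X

@[simp] theorem coaddLin_apply (f : MagAlg K X) : coaddLin K X f = coadd K X f := rfl

/-- The convolution square of the identity, i.e. co-addition followed by multiplication. -/
noncomputable def square (K X : Type*) [Field K] : Module.End K (MagAlg K X) :=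
  LinearMap.mul' K (MagAlg K X) ∘ₗ coaddLin K X

theorem square_apply (f : MagAlg K X) : square K X f = LinearMap.mul' K _ (coadd K X f) := rfl

theorem square_one : square K X 1 = 1 := by simp [square_apply, coadd_one]

theorem square_of_isPrimitive {f : MagAlg K X} (hf : IsPrimitive f) :
    square K X f = (2 : K) • f := by
  rw [square_apply, hf]
  simp [two_smul]

section

variable {A : Type*} [NonUnitalNonAssocSemiring A] [Module K A] [IsScalarTower K A A]
  [SMulCommClass K A A]

theorem mul'_tensor (z : (A ⊗[K] A) ⊗[K] (A ⊗[K] A)) :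
    LinearMap.mul' K (A ⊗[K] A) z = TensorProduct.map (LinearMap.mul' K A) (LinearMap.mul' K A)
      (TensorProduct.tensorTensorTensorComm K A A A A z) := by
  have : LinearMap.mul' K (A ⊗[K] A) =
      TensorProduct.map (LinearMap.mul' K A) (LinearMap.mul' K A) ∘ₗ
      (TensorProduct.tensorTensorTensorComm K A A A A).toLinearMap := by
    ext a b c d
    simp
  exact LinearMap.congr_fun this z

theorem tensorTensorTensorComm_mul (x y : (A ⊗[K] A) ⊗[K] (A ⊗[K] A)) :
    TensorProduct.tensorTensorTensorComm K A A A A (x * y) =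
      TensorProduct.tensorTensorTensorComm K A A A A x *
        TensorProduct.tensorTensorTensorComm K A A A A y := by
  have : (LinearMap.mul K ((A ⊗[K] A) ⊗[K] (A ⊗[K] A))).compr₂
        (TensorProduct.tensorTensorTensorComm K A A A A).toLinearMap =
      (LinearMap.mul K ((A ⊗[K] A) ⊗[K] (A ⊗[K] A))).compl₁₂
        (TensorProduct.tensorTensorTensorComm K A A A A).toLinearMap
        (TensorProduct.tensorTensorTensorComm K A A A A).toLinearMap := by
    ext a b c d a' b' c' d'
    simp
  exact LinearMap.congr_fun (LinearMap.congr_fun this x) y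

end

/-- Both sides are multiplicative, and a variable goes to the sum of its four placements, which is
symmetric. This replaces coassociativity and cocommutativity. -/
theorem coadd_coadd_comm (f : MagAlg K X) :
    TensorProduct.tensorTensorTensorComm K _ _ _ _
      (TensorProduct.map (coaddLin K X) (coaddLin K X) (coadd K X f)) =
      TensorProduct.map (coaddLin K X) (coaddLin K X) (coadd K X f) := by
  set Δ := coaddLin K X
  have hΔ : ∀ a b, Δ (a * b) = Δ a * Δ b := fun a b => map_mul (coadd K X) a b
  have h1 : Δ 1 = 1 ⊗ₜ[K] 1 := coadd_one
  have hx : ∀ x, Δ (var K x) = var K x ⊗ₜ[K] 1 + 1 ⊗ₜ[K] var K x := coadd_var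
  have key : (TensorProduct.tensorTensorTensorComm K _ _ _ _).toLinearMap ∘ₗ
      TensorProduct.map Δ Δ ∘ₗ Δ = TensorProduct.map Δ Δ ∘ₗ Δ := by
    apply linearMap_ext_of_mul
      (B := (MagAlg K X ⊗[K] MagAlg K X) ⊗[K] (MagAlg K X ⊗[K] MagAlg K X))
    · intro a b
      simp only [LinearMap.comp_apply, LinearEquiv.coe_coe, hΔ, tensorMap_mul hΔ hΔ,
        tensorTensorTensorComm_mul]
    · intro a b
      simp only [LinearMap.comp_apply, hΔ, tensorMap_mul hΔ hΔ]
    · simp [h1]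
    · intro x
      simp [h1, hx, TensorProduct.add_tmul, TensorProduct.tmul_add]
      abel
  exact LinearMap.congr_fun key f

/-- Multiplication of A ⊗ A is μ ⊗ μ after the exchange of the middle factors, and the exchange does
not affect the iterated co-addition. Associativity of μ plays no role. -/
theorem coadd_square (f : MagAlg K X) :
    coadd K X (square K X f) = TensorProduct.map (square K X) (square K X) (coadd K X f) := by
  have h1 : ∀ z : MagAlg K X ⊗[K] MagAlg K X, coadd K X (LinearMap.mul' K _ z) =
      LinearMap.mul' K _ (TensorProduct.map (coaddLin K X) (coaddLin K X) z) := by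
    intro z
    induction z using TensorProduct.induction_on with
    | zero => simp
    | add a b ha hb => simp only [map_add, ha, hb]
    | tmul a b => simp
  rw [square_apply, h1, mul'_tensor, coadd_coadd_comm, square, TensorProduct.map_comp]
  rfl

/-- The span of the `s ⊗ t`, `s` and `t` nonempty trees with `deg s + deg t = n`. -/
noncomputable def tensorSpan (K X : Type*) [Field K] (n : ℕ) :
    Submodule K (MagAlg K X ⊗[K] MagAlg K X) :=
  Submodule.span K {z | ∃ s t : Tree₁ X, 0 < deg s ∧ 0 < deg t ∧ deg s + deg t = n ∧
    z = mon K s ⊗ₜ mon K t}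

/-- The span of the `s ⊗ t`, `s` and `t` trees with `deg s + deg t = n`. -/
noncomputable def tensorSpanUnit (K X : Type*) [Field K] (n : ℕ) :
    Submodule K (MagAlg K X ⊗[K] MagAlg K X) :=
  Submodule.span K {z | ∃ s t : Tree₁ X, deg s + deg t = n ∧ z = mon K s ⊗ₜ mon K t}

theorem tensorSpan_le (n : ℕ) : tensorSpan K X n ≤ tensorSpanUnit K X n := by
  refine Submodule.span_mono ?_
  rintro z ⟨s, t, _, _, h, hz⟩
  exact ⟨s, t, h, hz⟩

theorem tmul_mem_tensorSpanUnit {s t : Tree₁ X} {n : ℕ} (h : deg s + deg t = n) :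
    mon K s ⊗ₜ mon K t ∈ tensorSpanUnit K X n := Submodule.subset_span ⟨s, t, h, rfl⟩

theorem mul_mem_tensorSpan_left {p q : ℕ} {x y : MagAlg K X ⊗[K] MagAlg K X}
    (hx : x ∈ tensorSpan K X p) (hy : y ∈ tensorSpanUnit K X q) :
    x * y ∈ tensorSpan K X (p + q) := by
  refine mul_mem_of_mem_span ?_ hx hy
  rintro _ ⟨s, t, hs, ht, h, rfl⟩ _ ⟨s', t', h', rfl⟩
  refine Submodule.subset_span ⟨s * s', t * t', ?_, ?_, ?_, ?_⟩
  · rw [deg_mul]; omega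
  · rw [deg_mul]; omega
  · rw [deg_mul, deg_mul]; omega
  · simp [mon_mul_mon]

theorem mul_mem_tensorSpan_right {p q : ℕ} {x y : MagAlg K X ⊗[K] MagAlg K X}
    (hx : x ∈ tensorSpanUnit K X p) (hy : y ∈ tensorSpan K X q) :
    x * y ∈ tensorSpan K X (p + q) := by
  refine mul_mem_of_mem_span ?_ hx hy
  rintro _ ⟨s, t, h, rfl⟩ _ ⟨s', t', hs, ht, h', rfl⟩
  refine Submodule.subset_span ⟨s * s', t * t', ?_, ?_, ?_, ?_⟩
  · rw [deg_mul]; omega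
  · rw [deg_mul]; omega
  · rw [deg_mul, deg_mul]; omega
  · simp [mon_mul_mon]

/-- The reduced co-addition. -/
noncomputable def redCoadd (K X : Type*) [Field K] : MagAlg K X →ₗ[K] MagAlg K X ⊗[K] MagAlg K X :=
  coaddLin K X -
    ((TensorProduct.mk K (MagAlg K X) (MagAlg K X)).flip 1 + TensorProduct.mk K _ _ 1)

theorem redCoadd_apply (f : MagAlg K X) :
    redCoadd K X f = coadd K X f - (f ⊗ₜ 1 + 1 ⊗ₜ f) := rfl

theorem redCoadd_eq_zero {f : MagAlg K X} : redCoadd K X f = 0 ↔ IsPrimitive f := by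
  rw [redCoadd_apply, sub_eq_zero]; rfl

theorem redCoadd_square (f : MagAlg K X) :
    redCoadd K X (square K X f) =
      TensorProduct.map (square K X) (square K X) (redCoadd K X f) := by
  simp [redCoadd_apply, coadd_square, square_one]

theorem redCoadd_mon_mem {t : Tree₁ X} (ht : t ≠ 1) :
    redCoadd K X (mon K t) ∈ tensorSpan K X (deg t) := by
  induction t using tree_induction with
  | one => exact absurd rfl ht
  | of x =>
    have : redCoadd K X (var K x) = 0 := redCoadd_eq_zero.2 (coadd_var x)
    exact this ▸ zero_mem _
  | mul s t hs ih =>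
    specialize hs WithOne.coe_ne_one
    have ht := ih WithOne.coe_ne_one
    clear ih
    have hs0 := deg_coe_pos s
    have ht0 := deg_coe_pos t
    have unit_mem : ∀ t : Tree₁ X, mon K t ⊗ₜ[K] 1 + 1 ⊗ₜ mon K t ∈ tensorSpanUnit K X (deg t) :=
      fun t => add_mem (tmul_mem_tensorSpanUnit (t := 1) (by simp))
        (tmul_mem_tensorSpanUnit (s := 1) (by simp))
    set a := redCoadd K X (mon K (s : Tree₁ X)) with ha
    set b := redCoadd K X (mon K (t : Tree₁ X)) with hb
    rw [redCoadd_apply, eq_sub_iff_add_eq] at ha hb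
    -- Expansion of (a + s ⊗ 1 + 1 ⊗ s)(b + t ⊗ 1 + 1 ⊗ t): only st ⊗ 1 and 1 ⊗ st have an empty
    -- factor, and they cancel.
    have : redCoadd K X (mon K ((s : Tree₁ X) * t)) =
        a * b + a * (mon K (t : Tree₁ X) ⊗ₜ[K] 1 + 1 ⊗ₜ mon K (t : Tree₁ X)) +
        (mon K (s : Tree₁ X) ⊗ₜ[K] 1 + 1 ⊗ₜ mon K (s : Tree₁ X)) * b +
        (mon K (s : Tree₁ X) ⊗ₜ[K] mon K (t : Tree₁ X) +
          mon K (t : Tree₁ X) ⊗ₜ[K] mon K (s : Tree₁ X)) := by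
      rw [redCoadd_apply, ← mon_mul_mon, map_mul, ← ha, ← hb]
      simp only [add_mul, mul_add, Algebra.TensorProduct.tmul_mul_tmul, one_mul, mul_one]
      abel
    rw [this, deg_mul]
    refine add_mem (add_mem (add_mem (mul_mem_tensorSpan_left hs (tensorSpan_le _ ht))
      (mul_mem_tensorSpan_left hs (unit_mem _))) (mul_mem_tensorSpan_right (unit_mem _) ht))
      (add_mem (Submodule.subset_span ⟨_, _, hs0, ht0, rfl, rfl⟩)
      (Submodule.subset_span ⟨_, _, ht0, hs0, add_comm _ _, rfl⟩))

theorem redCoadd_mem {f : MagAlg K X} {n : ℕ} (hn : 1 ≤ n) (hf : IsHomogeneous f n) :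
    redCoadd K X f ∈ tensorSpan K X n := by
  refine map_mem_of_mem_treeSpan ?_ (isHomogeneous_iff.1 hf)
  rintro t rfl
  exact redCoadd_mon_mem fun h => by simp [h] at hn

theorem square_isHomogeneous {f : MagAlg K X} {n : ℕ} (hf : IsHomogeneous f n) :
    IsHomogeneous (square K X f) n := by
  rw [isHomogeneous_iff] at hf ⊢
  refine map_mem_of_mem_treeSpan ?_ hf
  rintro t rfl
  rcases eq_or_ne t 1 with rfl | ht
  · rw [mon_one, square_one]
    exact mon_mem_treeSpan (t := 1) rfl
  · have h := redCoadd_mon_mem (K := K) ht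
    have h2 : square K X (mon K t) = mon K t + mon K t +
        LinearMap.mul' K _ (redCoadd K X (mon K t)) := by
      rw [redCoadd_apply, map_sub, square_apply]; simp
    rw [h2]
    refine add_mem (add_mem (mon_mem_treeSpan rfl) (mon_mem_treeSpan rfl)) ?_
    refine (Submodule.span_le (p := (treeSpan K {s | deg s = deg t}).comap _)).2 ?_ h
    rintro _ ⟨r, s, _, _, hd, rfl⟩
    simp only [Submodule.comap_coe, Set.mem_preimage, SetLike.mem_coe, LinearMap.mul'_apply,
      mon_mul_mon]
    exact mon_mem_treeSpan (by simpa using hd)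

theorem aeval_square_isHomogeneous (p : Polynomial K) {f : MagAlg K X} {n : ℕ}
    (hf : IsHomogeneous f n) : IsHomogeneous (Polynomial.aeval (square K X) p f) n := by
  rw [isHomogeneous_iff] at hf ⊢
  induction p using Polynomial.induction_on' with
  | add p q hp hq => rw [map_add, LinearMap.add_apply]; exact add_mem hp hq
  | monomial k a =>
    simp only [Polynomial.aeval_monomial, Module.End.mul_apply, Module.algebraMap_end_apply]
    refine Submodule.smul_mem _ _ ?_
    induction k with
    | zero => exact hf
    | succ k ih =>
      rw [pow_succ', Module.End.mul_apply]
      exact isHomogeneous_iff.1 (square_isHomogeneous (isHomogeneous_iff.2 ih))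

/-- The two claims feed each other. The reduced co-addition of f involves only factors of smaller
degree, which are sums of eigenvectors by induction; this gives primitivity. Then Ψ is 2 on p(Ψ) f,
so (X - 2) p annihilates f and f is itself a sum of eigenvectors. -/
theorem isPrimitive_eulerPoly_and_mem_span [CharZero K] {n : ℕ} (hn : 1 ≤ n) {f : MagAlg K X}
    (hf : IsHomogeneous f n) :
    IsPrimitive (Polynomial.aeval (square K X) (eulerPoly K n) f) ∧
      f ∈ Submodule.span K {v | ∃ k ∈ Finset.Icc 1 n, square K X v = (2 : K) ^ k • v} := by
  induction n using Nat.strong_induction_on generalizing f with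
  | _ n ih =>
    have hprim : IsPrimitive (Polynomial.aeval (square K X) (eulerPoly K n) f) := by
      rw [← redCoadd_eq_zero, aeval_apply_of_intertwines redCoadd_square, ← Submodule.mem_bot K]
      refine (Submodule.span_le (p := (⊥ : Submodule K (MagAlg K X ⊗[K] MagAlg K X)).comap
        (Polynomial.aeval (TensorProduct.map (square K X) (square K X)) (eulerPoly K n)))).2 ?_
        (redCoadd_mem hn hf)
      rintro _ ⟨s, t, hs, ht, hst, rfl⟩
      have hs' := (ih (deg s) (by omega) hs (f := mon K s)
        (isHomogeneous_iff.2 (mon_mem_treeSpan rfl))).2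
      have ht' := (ih (deg t) (by omega) ht (f := mon K t)
        (isHomogeneous_iff.2 (mon_mem_treeSpan rfl))).2
      set L := Polynomial.aeval (TensorProduct.map (square K X) (square K X)) (eulerPoly K n)
      have h1 : ∀ a ∈ {v | ∃ k ∈ Finset.Icc 1 (deg s), square K X v = (2 : K) ^ k • v},
          a ⊗ₜ[K] mon K t ∈ LinearMap.ker L := by
        rintro a ⟨i, hi, ha⟩
        refine (Submodule.span_le (p := (LinearMap.ker L).comap (TensorProduct.mk K _ _ a))).2 ?_ ht'
        rintro b ⟨j, hj, hb⟩
        rw [Finset.mem_Icc] at hi hj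
        have : TensorProduct.map (square K X) (square K X) (a ⊗ₜ b) =
            (2 : K) ^ (i + j) • (a ⊗ₜ[K] b) := by
          rw [TensorProduct.map_tmul, ha, hb, TensorProduct.smul_tmul_smul, pow_add]
        change L (a ⊗ₜ b) = 0
        -- Here 2 ≤ i + j ≤ deg s + deg t = n, so the eigenvalue is a root of p.
        rw [aeval_apply_of_eigenvector this, eulerPoly_eval_two_pow (by omega) (by omega), zero_smul]
      have h2 : mon K s ⊗ₜ[K] mon K t ∈ LinearMap.ker L :=
        (Submodule.span_le (p := (LinearMap.ker L).comap
          ((TensorProduct.mk K (MagAlg K X) (MagAlg K X)).flip (mon K t)))).2 h1 hs'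
      simpa using h2
    exact ⟨hprim, mem_span_eigenvectors_of_eulerPoly hn (square_of_isPrimitive hprim)⟩

end Square

/-! ### Kernels and tensor products over a field -/

section KerTensor

variable {K U V W : Type*} [Field K] [AddCommGroup U] [Module K U] [AddCommGroup V] [Module K V]
  [AddCommGroup W] [Module K W]

theorem exists_eq_comp_of_ker_le_ker {D : V →ₗ[K] W} {q : V →ₗ[K] U}
    (h : LinearMap.ker D ≤ LinearMap.ker q) : ∃ S : W →ₗ[K] U, q = S ∘ₗ D := by
  obtain ⟨S, hS⟩ := LinearMap.exists_extend
    ((LinearMap.ker D).liftQ q h ∘ₗ D.quotKerEquivRange.symm.toLinearMap)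
  refine ⟨S, LinearMap.ext fun v => ?_⟩
  have := LinearMap.congr_fun hS ⟨D v, v, rfl⟩
  have h2 : D.quotKerEquivRange.symm ⟨D v, v, rfl⟩ = Submodule.Quotient.mk v := by
    rw [LinearEquiv.symm_apply_eq]; rfl
  simp only [LinearMap.comp_apply, Submodule.subtype_apply, LinearEquiv.coe_coe, h2] at this
  exact this.symm

/-- If `e` maps `U` isomorphically onto the kernel of `D`, then `e ⊗ e` maps `U ⊗ U` onto the
intersection of the kernels of `D ⊗ 1` and `1 ⊗ D`. -/
theorem mem_range_map_of_ker {D : V →ₗ[K] V} {e : U →ₗ[K] V} (he : Function.Injective e)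
    (hr : LinearMap.range e = LinearMap.ker D) {z : V ⊗[K] V}
    (h1 : TensorProduct.map D LinearMap.id z = 0) (h2 : TensorProduct.map LinearMap.id D z = 0) :
    ∃ w, TensorProduct.map e e w = z := by
  obtain ⟨r, hre⟩ := LinearMap.exists_leftInverse_of_injective e (LinearMap.ker_eq_bot.2 he)
  -- The complement of the projection e ∘ r onto ker D vanishes on ker D, so it factors through D;
  -- hence e ∘ r fixes z in each tensor factor.
  obtain ⟨S, hS⟩ := exists_eq_comp_of_ker_le_ker (D := D) (q := LinearMap.id - e ∘ₗ r) (by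
    rw [← hr]
    rintro _ ⟨u, rfl⟩
    simpa [sub_eq_zero] using congrArg e (LinearMap.congr_fun hre u).symm)
  have hL : TensorProduct.map (e ∘ₗ r) LinearMap.id z = z := by
    have := congrArg (TensorProduct.map S (LinearMap.id : V →ₗ[K] V)) h1
    rw [← LinearMap.comp_apply, ← TensorProduct.map_comp, ← hS, map_zero, LinearMap.id_comp] at this
    change LinearMap.rTensor V _ z = 0 at this
    rw [LinearMap.rTensor_sub, LinearMap.sub_apply, LinearMap.rTensor_id, LinearMap.id_apply,
      sub_eq_zero] at this
    exact this.symm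
  have hR : TensorProduct.map LinearMap.id (e ∘ₗ r) z = z := by
    have := congrArg (TensorProduct.map (LinearMap.id : V →ₗ[K] V) S) h2
    rw [← LinearMap.comp_apply, ← TensorProduct.map_comp, ← hS, map_zero, LinearMap.id_comp] at this
    change LinearMap.lTensor V _ z = 0 at this
    rw [LinearMap.lTensor_sub, LinearMap.sub_apply, LinearMap.lTensor_id, LinearMap.id_apply,
      sub_eq_zero] at this
    exact this.symm
  refine ⟨TensorProduct.map r r z, ?_⟩
  rw [← LinearMap.comp_apply, ← TensorProduct.map_comp]
  conv_rhs => rw [← hL, ← hR]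
  rw [← LinearMap.comp_apply, ← TensorProduct.map_comp, LinearMap.id_comp, LinearMap.comp_id]

end KerTensor

/-! ### Compatibility of d/dx with the co-addition -/

section Constants

variable {K : Type*} [Field K]

theorem map_ddx_id_mul (x y : MagAlg K Unit ⊗[K] MagAlg K Unit) :
    TensorProduct.map (ddx K) LinearMap.id (x * y) =
      TensorProduct.map (ddx K) LinearMap.id x * y +
        x * TensorProduct.map (ddx K) LinearMap.id y := by
  induction x using TensorProduct.induction_on with
  | zero => simp
  | add x₁ x₂ h₁ h₂ => simp only [add_mul, map_add, h₁, h₂]; abel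
  | tmul a b =>
    induction y using TensorProduct.induction_on with
    | zero => simp
    | add x₁ x₂ h₁ h₂ => simp only [mul_add, map_add, h₁, h₂]; abel
    | tmul c d => simp [Algebra.TensorProduct.tmul_mul_tmul, ddx_mul, TensorProduct.add_tmul]

theorem map_id_ddx_mul (x y : MagAlg K Unit ⊗[K] MagAlg K Unit) :
    TensorProduct.map LinearMap.id (ddx K) (x * y) =
      TensorProduct.map LinearMap.id (ddx K) x * y +
        x * TensorProduct.map LinearMap.id (ddx K) y := by
  induction x using TensorProduct.induction_on with
  | zero => simp
  | add x₁ x₂ h₁ h₂ => simp only [add_mul, map_add, h₁, h₂]; abel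
  | tmul a b =>
    induction y using TensorProduct.induction_on with
    | zero => simp
    | add x₁ x₂ h₁ h₂ => simp only [mul_add, map_add, h₁, h₂]; abel
    | tmul c d => simp [Algebra.TensorProduct.tmul_mul_tmul, ddx_mul, TensorProduct.tmul_add]

/-- Both sides satisfy the Leibniz rule along Δ and take the value 1 ⊗ 1 at x. -/
theorem map_ddx_id_coadd (f : MagAlg K Unit) :
    TensorProduct.map (ddx K) LinearMap.id (coadd K Unit f) = coadd K Unit (ddx K f) := by
  have : TensorProduct.map (ddx K) LinearMap.id ∘ₗ coaddLin K Unit = coaddLin K Unit ∘ₗ ddx K := by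
    refine linearMap_ext_mon fun t => ?_
    simp only [LinearMap.comp_apply, coaddLin_apply]
    induction t using tree_induction with
    | one => simp [mon_one, coadd_one, ddx_one]
    | of x =>
      change TensorProduct.map _ _ (coadd K Unit (var K ())) = coadd K Unit (ddx K (var K ()))
      simp [coadd_var, ddx_var, ddx_one, coadd_one]
    | mul s t hs ht => rw [← mon_mul_mon, map_mul, map_ddx_id_mul, hs, ht, ddx_mul]; simp
  exact LinearMap.congr_fun this f

theorem map_id_ddx_coadd (f : MagAlg K Unit) :
    TensorProduct.map LinearMap.id (ddx K) (coadd K Unit f) = coadd K Unit (ddx K f) := by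
  have : TensorProduct.map LinearMap.id (ddx K) ∘ₗ coaddLin K Unit = coaddLin K Unit ∘ₗ ddx K := by
    refine linearMap_ext_mon fun t => ?_
    simp only [LinearMap.comp_apply, coaddLin_apply]
    induction t using tree_induction with
    | one => simp [mon_one, coadd_one, ddx_one]
    | of x =>
      change TensorProduct.map _ _ (coadd K Unit (var K ())) = coadd K Unit (ddx K (var K ()))
      simp [coadd_var, ddx_var, ddx_one, coadd_one]
    | mul s t hs ht => rw [← mon_mul_mon, map_mul, map_id_ddx_mul, hs, ht, ddx_mul]; simp
  exact LinearMap.congr_fun this f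

end Constants

/-! ### The counit and linear parts -/

section Counit

variable {K X : Type*} [Field K]

/-- A variable is a product of two trees only if one of them is empty. -/
theorem coeffAt_var_mul (x : X) (f g : MagAlg K X) :
    (f * g).coeff ((FreeMagma.of x : FreeMagma X) : Tree₁ X) =
      f.coeff 1 * g.coeff ((FreeMagma.of x : FreeMagma X) : Tree₁ X) +
        f.coeff ((FreeMagma.of x : FreeMagma X) : Tree₁ X) * g.coeff 1 := by
  set v : Tree₁ X := ((FreeMagma.of x : FreeMagma X) : Tree₁ X) with hv
  have key : ∀ s t : Tree₁ X, (mon K s * mon K t).coeff v =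
      (mon K s).coeff 1 * (mon K t).coeff v + (mon K s).coeff v * (mon K t).coeff 1 := by
    intro s t
    classical
    have h1 : (1 : Tree₁ X) ≠ v := WithOne.one_ne_coe
    rcases eq_or_ne s 1 with rfl | hs
    · simp [mon_mul_mon, coeff_mon, h1]
    rcases eq_or_ne t 1 with rfl | ht
    · simp [mon_mul_mon, coeff_mon, h1, hs]
    have hst : s * t ≠ v := by
      intro h
      have := congrArg deg h
      rw [deg_mul, hv, deg_of] at this
      have := deg_eq_zero.not.2 hs
      have := deg_eq_zero.not.2 ht
      omega
    simp [mon_mul_mon, coeff_mon, hs, ht, hst]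
  have : (LinearMap.mul K (MagAlg K X)).compr₂ (coeffAt K v)
      = (LinearMap.mul K K).compl₁₂ (coeffAt K (1 : Tree₁ X)) (coeffAt K v) +
        (LinearMap.mul K K).compl₁₂ (coeffAt K v) (coeffAt K (1 : Tree₁ X)) :=
    (monBasis K X).ext fun s => (monBasis K X).ext fun t => key s t
  exact LinearMap.congr_fun (LinearMap.congr_fun this f) g

/-- `f ⊗ g ↦ f(0) g`. -/
noncomputable def counitLeft (K X : Type*) [Field K] : MagAlg K X ⊗[K] MagAlg K X →ₗ[K] MagAlg K X :=
  (TensorProduct.lid K _).toLinearMap ∘ₗ TensorProduct.map (coeffAt K 1) LinearMap.id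

/-- `f ⊗ g ↦ g(0) f`. -/
noncomputable def counitRight (K X : Type*) [Field K] :
    MagAlg K X ⊗[K] MagAlg K X →ₗ[K] MagAlg K X :=
  (TensorProduct.rid K _).toLinearMap ∘ₗ TensorProduct.map LinearMap.id (coeffAt K 1)

@[simp] theorem counitLeft_tmul (f g : MagAlg K X) :
    counitLeft K X (f ⊗ₜ g) = f.coeff 1 • g := by simp [counitLeft]

@[simp] theorem counitRight_tmul (f g : MagAlg K X) :
    counitRight K X (f ⊗ₜ g) = g.coeff 1 • f := by simp [counitRight]

theorem counitLeft_mul (x y : MagAlg K X ⊗[K] MagAlg K X) :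
    counitLeft K X (x * y) = counitLeft K X x * counitLeft K X y := by
  induction x using TensorProduct.induction_on with
  | zero => simp
  | add x₁ x₂ h₁ h₂ => simp only [add_mul, map_add, h₁, h₂]
  | tmul a b =>
    induction y using TensorProduct.induction_on with
    | zero => simp
    | add x₁ x₂ h₁ h₂ => simp only [mul_add, map_add, h₁, h₂]
    | tmul c d =>
      rw [Algebra.TensorProduct.tmul_mul_tmul]
      simp only [counitLeft_tmul, coeff_one_mul, smul_mul_smul_comm]

theorem counitRight_mul (x y : MagAlg K X ⊗[K] MagAlg K X) :
    counitRight K X (x * y) = counitRight K X x * counitRight K X y := by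
  induction x using TensorProduct.induction_on with
  | zero => simp
  | add x₁ x₂ h₁ h₂ => simp only [add_mul, map_add, h₁, h₂]
  | tmul a b =>
    induction y using TensorProduct.induction_on with
    | zero => simp
    | add x₁ x₂ h₁ h₂ => simp only [mul_add, map_add, h₁, h₂]
    | tmul c d =>
      rw [Algebra.TensorProduct.tmul_mul_tmul]
      simp only [counitRight_tmul, coeff_one_mul, smul_mul_smul_comm]

theorem coeff_one_one : (1 : MagAlg K X).coeff 1 = 1 := MonoidAlgebra.coeff_one_one

theorem coeff_one_var (x : X) : (var K x).coeff 1 = 0 := by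
  classical
  rw [var, coeff_mon, if_neg WithOne.coe_ne_one]

theorem counitLeft_coadd (f : MagAlg K X) : counitLeft K X (coadd K X f) = f := by
  have : counitLeft K X ∘ₗ coaddLin K X = LinearMap.id := by
    apply linearMap_ext_of_mul
    · intro a b; simp [counitLeft_mul]
    · intro a b; rfl
    · simp [coadd_one]
    · intro x; simp [coadd_var, coeff_one_var]
  exact LinearMap.congr_fun this f

theorem counitRight_coadd (f : MagAlg K X) : counitRight K X (coadd K X f) = f := by
  have : counitRight K X ∘ₗ coaddLin K X = LinearMap.id := by
    apply linearMap_ext_of_mul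
    · intro a b; simp [counitRight_mul]
    · intro a b; rfl
    · simp [coadd_one]
    · intro x; simp [coadd_var, coeff_one_var]
  exact LinearMap.congr_fun this f

theorem coeff_one_mul' (z : MagAlg K X ⊗[K] MagAlg K X) :
    (LinearMap.mul' K (MagAlg K X) z).coeff 1 = (counitLeft K X z).coeff 1 := by
  induction z using TensorProduct.induction_on with
  | zero => simp
  | add x₁ x₂ h₁ h₂ => simp only [map_add, MonoidAlgebra.coeff_add, Finsupp.add_apply, h₁, h₂]
  | tmul a b => simp [coeff_one_mul]

/-- For z a co-addition both counits return the original element, so the convolution square doubles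
linear parts. -/
theorem coeff_var_mul' (x : X) (z : MagAlg K X ⊗[K] MagAlg K X) :
    (LinearMap.mul' K (MagAlg K X) z).coeff ((FreeMagma.of x : FreeMagma X) : Tree₁ X) =
      (counitLeft K X z).coeff ((FreeMagma.of x : FreeMagma X) : Tree₁ X) +
        (counitRight K X z).coeff ((FreeMagma.of x : FreeMagma X) : Tree₁ X) := by
  induction z using TensorProduct.induction_on with
  | zero => simp
  | add x₁ x₂ h₁ h₂ =>
    simp only [map_add, MonoidAlgebra.coeff_add, Finsupp.add_apply, h₁, h₂]; ring
  | tmul a b => simp [coeffAt_var_mul, mul_comm]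

end Counit

/-! ### Substitutions with identical linear part -/

section Strict

variable {K X : Type*} [Field K]

/-- The linear map underlying the substitution homomorphism. -/
noncomputable def liftLin {Y : Type*} (y : Y → MagAlg K X) : MagAlg K Y →ₗ[K] MagAlg K X :=
  (lift y : MagAlg K Y →ₙₐ[K] MagAlg K X)

@[simp] theorem liftLin_apply {Y : Type*} (y : Y → MagAlg K X) (f : MagAlg K Y) :
    liftLin y f = lift y f := rfl

theorem coeff_one_lift {Y : Type*} {y : Y → MagAlg K X} (hy : ∀ i, (y i).coeff 1 = 0)
    (f : MagAlg K Y) : (lift y f).coeff 1 = f.coeff 1 := by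
  have : coeffAt K 1 ∘ₗ liftLin y = coeffAt K 1 := by
    apply linearMap_ext_of_mul
    · intro a b; simp [coeff_one_mul]
    · intro a b; simp [coeff_one_mul]
    · simp [lift_one]
    · intro i; simp [lift_var, hy, coeff_one_var]
  exact LinearMap.congr_fun this f

variable {g : X → MagAlg K X}
  (hg : ∀ (x : X) (t : Tree₁ X), deg t ≤ 1 → (g x).coeff t = (var K x).coeff t)

include hg

theorem lift_mon_sub_mem (t : Tree₁ X) :
    lift g (mon K t) - mon K t ∈ treeSpan K {s | deg t + 1 ≤ deg s} := by
  induction t using tree_induction with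
  | one => rw [mon_one, lift_one, sub_self]; exact zero_mem _
  | of x =>
    change lift g (var K x) - var K x ∈ _
    rw [lift_var, mem_treeSpan]
    intro s hs
    by_contra h
    rw [Set.mem_ofPred_eq, deg_of] at h
    exact hs (by rw [MonoidAlgebra.coeff_sub, Finsupp.sub_apply, hg x s (by omega), sub_self])
  | mul s t hs ht =>
    have : lift g (mon K ((s : Tree₁ X) * (t : Tree₁ X))) - mon K ((s : Tree₁ X) * (t : Tree₁ X)) =
        (lift g (mon K (s : Tree₁ X)) - mon K (s : Tree₁ X)) *
            (lift g (mon K (t : Tree₁ X)) - mon K (t : Tree₁ X)) +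
          (lift g (mon K (s : Tree₁ X)) - mon K (s : Tree₁ X)) * mon K (t : Tree₁ X) +
          mon K (s : Tree₁ X) * (lift g (mon K (t : Tree₁ X)) - mon K (t : Tree₁ X)) := by
      rw [← mon_mul_mon, map_mul]
      simp only [sub_mul, mul_sub]
      abel
    rw [this]
    have hs' : mon K (s : Tree₁ X) ∈ treeSpan K {r | deg (s : Tree₁ X) ≤ deg r} :=
      mon_mem_treeSpan (Set.mem_ofPred_eq ▸ le_refl _)
    have ht' : mon K (t : Tree₁ X) ∈ treeSpan K {r | deg (t : Tree₁ X) ≤ deg r} :=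
      mon_mem_treeSpan (Set.mem_ofPred_eq ▸ le_refl _)
    refine add_mem (add_mem (mul_mem_treeSpan ?_ hs ht) (mul_mem_treeSpan ?_ hs ht'))
      (mul_mem_treeSpan ?_ hs' ht)
    all_goals
      intro a ha b hb
      simp only [Set.mem_ofPred_eq, deg_mul] at *
      omega

theorem coeff_lift_of_strict (f : MagAlg K X) {t : Tree₁ X} (ht : deg t ≤ 1) :
    (lift g f).coeff t = f.coeff t := by
  have h : (liftLin g - LinearMap.id : MagAlg K X →ₗ[K] MagAlg K X) f ∈
      treeSpan K {s : Tree₁ X | 2 ≤ deg s} := by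
    refine map_mem_of_mem_treeSpan ?_ (mem_treeSpan_univ f)
    intro s _
    rcases eq_or_ne s 1 with rfl | hs
    · rw [mon_one]; simp [lift_one]
    · refine treeSpan_mono ?_ (lift_mon_sub_mem hg s)
      intro r hr
      have := deg_eq_zero.not.2 hs
      simp only [Set.mem_ofPred_eq] at *
      omega
  by_contra hne
  have := mem_treeSpan.1 h t (by simpa [sub_eq_zero] using hne)
  simp only [Set.mem_ofPred_eq] at this
  omega

/-- The substitution changes a tree only by terms of larger degree, so the terms of lowest degree
survive. -/
theorem lift_injective_of_strict : Function.Injective (lift g : MagAlg K X →ₙₐ[K] MagAlg K X) := by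
  change Function.Injective (liftLin g)
  refine (injective_iff_map_eq_zero (liftLin g)).2 fun f hf => ?_
  by_contra hne
  have hs : f.coeff.support.Nonempty :=
    Finsupp.support_nonempty_iff.2 (MonoidAlgebra.coeff_eq_zero.not.2 hne)
  obtain ⟨t, ht, hmin⟩ := Finset.exists_min_image _ deg hs
  have h : (liftLin g - LinearMap.id : MagAlg K X →ₗ[K] MagAlg K X) f ∈
      treeSpan K {s : Tree₁ X | deg t + 1 ≤ deg s} := by
    refine map_mem_of_mem_treeSpan (S := {s | deg t ≤ deg s}) ?_
      (mem_treeSpan.2 fun s hs => hmin s (Finsupp.mem_support_iff.2 hs))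
    intro s hs
    refine treeSpan_mono ?_ (lift_mon_sub_mem hg s)
    intro r hr
    simp only [Set.mem_ofPred_eq] at *
    omega
  rw [LinearMap.sub_apply, hf, zero_sub] at h
  have := mem_treeSpan.1 h t (by simpa using Finsupp.mem_support_iff.1 ht)
  simp at this

/-- Strictness alone does not suffice: x ↦ x + x * x is not surjective. With weights, each term of g
x - x is a product of two trees of smaller weight than x, so induction on the weight applies. -/
theorem lift_surjective_of_strict {w : X → ℕ} (hw : ∀ x, 0 < w x)
    (hgw : ∀ x, g x ∈ treeSpan K {t | wdeg w t = w x}) :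
    Function.Surjective (lift g : MagAlg K X →ₙₐ[K] MagAlg K X) := by
  have hpos : ∀ t : FreeMagma X, 0 < wdeg w (t : Tree₁ X) := by
    intro t
    induction t using FreeMagma.recOnMul with
    | ih1 x => exact hw x
    | ih2 s t hs ht => rw [WithOne.coe_mul, wdeg_mul]; omega
  have hmul : ∀ {a b}, a ∈ LinearMap.range (liftLin g) → b ∈ LinearMap.range (liftLin g) →
      a * b ∈ LinearMap.range (liftLin g) := by
    rintro _ _ ⟨a, rfl⟩ ⟨b, rfl⟩
    exact ⟨a * b, lift_mul g a b⟩
  have key : ∀ n, ∀ t : Tree₁ X, wdeg w t = n → mon K t ∈ LinearMap.range (liftLin g) := by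
    intro n
    induction n using Nat.strong_induction_on with
    | _ n ih =>
      intro t ht
      have hprod : ∀ s t : FreeMagma X, wdeg w ((s : Tree₁ X) * (t : Tree₁ X)) = n →
          mon K ((s : Tree₁ X) * (t : Tree₁ X)) ∈ LinearMap.range (liftLin g) := by
        intro s t h
        rw [wdeg_mul] at h
        have := hpos s
        have := hpos t
        rw [← mon_mul_mon]
        exact hmul (ih _ (by omega) _ rfl) (ih _ (by omega) _ rfl)
      induction t using tree_induction with
      | one => exact ⟨1, lift_one g⟩
      | of x =>
        rw [wdeg_of] at ht
        change var K x ∈ _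
        have h : g x - var K x ∈ treeSpan K {t | 2 ≤ deg t ∧ wdeg w t = n} := by
          rw [mem_treeSpan]
          intro t hne
          refine ⟨?_, ?_⟩
          · by_contra hd
            exact hne (by rw [MonoidAlgebra.coeff_sub, Finsupp.sub_apply, hg x t (by omega),
              sub_self])
          · have : g x - var K x ∈ treeSpan K {t | wdeg w t = w x} :=
              sub_mem (hgw x) (mon_mem_treeSpan rfl)
            exact (mem_treeSpan.1 this t hne).trans ht
        have h2 : g x - var K x ∈ LinearMap.range (liftLin g) := by
          refine map_mem_of_mem_treeSpan (L := LinearMap.id) ?_ h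
          rintro t ⟨ht2, htw⟩
          induction t using tree_induction with
          | one => simp at ht2
          | of x => simp at ht2
          | mul s t _ _ => exact hprod s t htw
        have h3 : g x ∈ LinearMap.range (liftLin g) := ⟨var K x, lift_var g x⟩
        simpa using sub_mem h3 h2
      | mul s t _ _ => exact hprod s t ht
  intro f
  exact map_mem_of_mem_treeSpan (L := LinearMap.id) (fun t _ => key _ t rfl) (mem_treeSpan_univ f)

end Strict

/-! ### Restricted co-addition, the automorphism and primitive generators -/

section GradedFreeGenSeq

variable {K : Type*} [Field K] {y : ℕ → MagAlg K Unit} {d : ℕ → ℕ}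

theorem isRestrictedCoadd_iff {Δ' : MagAlg K ℕ →ₙₐ[K] MagAlg K ℕ ⊗[K] MagAlg K ℕ} :
    IsRestrictedCoadd y Δ' ↔
      ∀ f, TensorProduct.map (liftLin y) (liftLin y) (Δ' f) = coadd K Unit (lift y f) := Iff.rfl

theorem tensorMap_liftLin_mul {X Y : Type*} (y : Y → MagAlg K X)
    (a b : MagAlg K Y ⊗[K] MagAlg K Y) :
    TensorProduct.map (liftLin y) (liftLin y) (a * b) =
      TensorProduct.map (liftLin y) (liftLin y) a * TensorProduct.map (liftLin y) (liftLin y) b :=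
  tensorMap_mul (lift_mul y) (lift_mul y) a b

theorem tensorMap_liftLin_injective {X Y : Type*} {y : Y → MagAlg K X}
    (h : Function.Injective (liftLin y)) :
    Function.Injective (TensorProduct.map (liftLin y) (liftLin y)) :=
  TensorProduct.map_injective_of_flat_flat _ _ h h

/-- Values exist because Δ commutes with d/dx in both factors. Injectivity of ε ⊗ ε gives uniqueness
and makes the chosen values an algebra homomorphism. -/
theorem existsUnique_isRestrictedCoadd (h : IsGradedFreeGenSeq y d) :
    ∃! Δ' : MagAlg K ℕ →ₙₐ[K] MagAlg K ℕ ⊗[K] MagAlg K ℕ, IsRestrictedCoadd y Δ' := by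
  have hinj := tensorMap_liftLin_injective (y := y) h.injective
  have hr : LinearMap.range (liftLin y) = LinearMap.ker (ddx K) := SetLike.coe_injective h.range_eq
  have hmem : ∀ f : MagAlg K ℕ, ddx K (lift y f) = 0 := fun f =>
    (hr ▸ LinearMap.mem_range_self (liftLin y) f : liftLin y f ∈ LinearMap.ker (ddx K))
  choose Δ' hΔ' using fun f : MagAlg K ℕ => mem_range_map_of_ker (z := coadd K Unit (lift y f))
    (e := liftLin y) h.injective hr
    (by rw [map_ddx_id_coadd, hmem, map_zero]) (by rw [map_id_ddx_coadd, hmem, map_zero])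
  refine ⟨{ toFun := Δ'
            map_smul' := fun c f => hinj ?_
            map_zero' := hinj ?_
            map_add' := fun f g => hinj ?_
            map_mul' := fun f g => hinj ?_ }, hΔ', fun D hD => ?_⟩
  · simp [hΔ']
  · simp [hΔ']
  · simp [hΔ']
  · rw [tensorMap_liftLin_mul, hΔ', hΔ', hΔ', map_mul, map_mul]
  · refine NonUnitalAlgHom.ext fun f => ?_
    exact hinj ((hD f).trans (hΔ' f).symm)

/-- A generator of degree 0 would be a scalar, and ε would identify its variable with a multiple of
1. -/
theorem IsGradedFreeGenSeq.degree_pos (h : IsGradedFreeGenSeq y d) (i : ℕ) : 0 < d i := by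
  by_contra h0
  have hd : IsHomogeneous (y i) 0 := by
    have := h.homogeneous i
    rwa [show d i = 0 by omega] at this
  have hy : y i = (y i).coeff 1 • 1 := by
    refine MonoidAlgebra.coeff_injective (Finsupp.ext fun t => ?_)
    rcases eq_or_ne t 1 with rfl | ht
    · simp
    · have : (y i).coeff t = 0 := by
        by_contra hne
        exact ht (deg_eq_zero.1 (hd t hne))
      rw [this, ← mon_one, MonoidAlgebra.coeff_smul, Finsupp.smul_apply]
      classical
      rw [coeff_mon, if_neg ht.symm, smul_zero]
  have hv : var K i = (y i).coeff 1 • (1 : MagAlg K ℕ) := by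
    apply h.injective
    rw [lift_var, map_smul, lift_one]
    exact hy
  have := congrArg (coeffAt K ((FreeMagma.of i : FreeMagma ℕ) : Tree₁ ℕ)) hv
  classical
  rw [map_smul, coeffAt_apply, coeffAt_apply, var, coeff_mon, if_pos rfl, ← mon_one, coeff_mon,
    if_neg WithOne.one_ne_coe, smul_zero] at this
  exact one_ne_zero this

theorem IsGradedFreeGenSeq.coeff_one (h : IsGradedFreeGenSeq y d) (i : ℕ) :
    (y i).coeff 1 = 0 := by
  by_contra hne
  have := h.homogeneous i 1 hne
  have := h.degree_pos i
  rw [deg_one] at *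
  omega

theorem lift_mon_isHomogeneous (hy : ∀ i, IsHomogeneous (y i) (d i)) (t : Tree₁ ℕ) :
    IsHomogeneous (lift y (mon K t)) (wdeg d t) := by
  rw [isHomogeneous_iff]
  induction t using tree_induction with
  | one => rw [mon_one, lift_one]; exact mon_mem_treeSpan (t := 1) rfl
  | of i =>
    change lift y (var K i) ∈ _
    rw [lift_var]
    exact isHomogeneous_iff.1 (hy i)
  | mul s t hs ht =>
    rw [← mon_mul_mon, map_mul]
    refine mul_mem_treeSpan ?_ hs ht
    intro a ha b hb
    simp only [Set.mem_ofPred_eq, deg_mul, wdeg_mul] at *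
    omega

theorem mem_treeSpan_wdeg_of_isHomogeneous_lift (h : IsGradedFreeGenSeq y d) {f : MagAlg K ℕ}
    {n : ℕ} (hf : IsHomogeneous (lift y f) n) : f ∈ treeSpan K {t | wdeg d t = n} := by
  classical
  have hS : ∀ (S : ℕ → Prop) (g : MagAlg K ℕ), g ∈ treeSpan K {t | S (wdeg d t)} →
      liftLin y g ∈ treeSpan K {t : Tree₁ Unit | S (deg t)} := by
    intro S g hg
    refine map_mem_of_mem_treeSpan ?_ hg
    intro t ht
    refine treeSpan_mono ?_ (isHomogeneous_iff.1 (lift_mon_isHomogeneous h.homogeneous t))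
    intro s hs
    simp only [Set.mem_ofPred_eq] at *
    rwa [hs]
  obtain ⟨p, hp⟩ : ∃ p : MagAlg K ℕ, p.coeff = f.coeff.filter fun t => wdeg d t = n :=
    ⟨MonoidAlgebra.ofCoeff _, rfl⟩
  have hpm : p ∈ treeSpan K {t | wdeg d t = n} := by
    rw [mem_treeSpan, hp]
    intro t ht
    by_contra hne
    exact ht (Finsupp.filter_apply_neg (fun t => wdeg d t = n) _ hne)
  have hqm : f - p ∈ treeSpan K {t | wdeg d t ≠ n} := by
    rw [mem_treeSpan]
    intro t ht hne
    refine ht ?_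
    rw [MonoidAlgebra.coeff_sub, Finsupp.sub_apply, hp,
      Finsupp.filter_apply_pos (fun t => wdeg d t = n) _ hne, sub_self]
  -- The image of the part of weight different from n is both of degree n and without terms of
  -- degree n.
  have h0 : liftLin y (f - p) = 0 := by
    refine MonoidAlgebra.coeff_injective (Finsupp.ext fun t => ?_)
    by_contra hne
    have h1 : liftLin y (f - p) ∈ treeSpan K {t : Tree₁ Unit | deg t = n} := by
      rw [map_sub]
      exact sub_mem (isHomogeneous_iff.1 hf) (hS (fun k => k = n) p hpm)
    exact mem_treeSpan.1 (hS (fun k => k ≠ n) _ hqm) t hne (mem_treeSpan.1 h1 t hne)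
  have h1 : f - p = 0 := (injective_iff_map_eq_zero (liftLin y)).1 h.injective _ h0
  rw [sub_eq_zero.1 h1]
  exact hpm

/-- The variables of `K{Y}` can be changed by terms of degree at least `2` such that the substitution
maps them to homogeneous primitive elements. -/
theorem exists_strict_primitive [CharZero K] (h : IsGradedFreeGenSeq y d) :
    ∃ g : ℕ → MagAlg K ℕ, (∀ i (t : Tree₁ ℕ), deg t ≤ 1 → (g i).coeff t = (var K i).coeff t) ∧
      (∀ i, IsHomogeneous (lift y (g i)) (d i)) ∧ ∀ i, IsPrimitive (lift y (g i)) := by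
  obtain ⟨Δ', hΔ', -⟩ := existsUnique_isRestrictedCoadd h
  rw [isRestrictedCoadd_iff] at hΔ'
  have hc := coeff_one_lift h.coeff_one
  -- The counit laws for Δ' are those of K{x}, since ε is injective and preserves constant terms.
  have hL : ∀ f, counitLeft K ℕ (Δ' f) = f := by
    have key : ∀ z, lift y (counitLeft K ℕ z) =
        counitLeft K Unit (TensorProduct.map (liftLin y) (liftLin y) z) := by
      intro z
      induction z using TensorProduct.induction_on with
      | zero => simp
      | add a b ha hb => simp only [map_add, ha, hb]
      | tmul a b => simp [hc]
    intro f
    apply h.injective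
    rw [key, hΔ', counitLeft_coadd]
  have hR : ∀ f, counitRight K ℕ (Δ' f) = f := by
    have key : ∀ z, lift y (counitRight K ℕ z) =
        counitRight K Unit (TensorProduct.map (liftLin y) (liftLin y) z) := by
      intro z
      induction z using TensorProduct.induction_on with
      | zero => simp
      | add a b ha hb => simp only [map_add, ha, hb]
      | tmul a b => simp [hc]
    intro f
    apply h.injective
    rw [key, hΔ', counitRight_coadd]
  set Ψ : Module.End K (MagAlg K ℕ) := LinearMap.mul' K (MagAlg K ℕ) ∘ₗ
    ((Δ' : MagAlg K ℕ →ₙₐ[K] MagAlg K ℕ ⊗[K] MagAlg K ℕ) :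
      MagAlg K ℕ →ₗ[K] MagAlg K ℕ ⊗[K] MagAlg K ℕ) with hΨ
  have hΨa : ∀ f, Ψ f = LinearMap.mul' K (MagAlg K ℕ) (Δ' f) := fun f => rfl
  have hΨy : ∀ f, liftLin y (Ψ f) = square K Unit (liftLin y f) := by
    have key : ∀ z, lift y (LinearMap.mul' K (MagAlg K ℕ) z) =
        LinearMap.mul' K (MagAlg K Unit) (TensorProduct.map (liftLin y) (liftLin y) z) := by
      intro z
      induction z using TensorProduct.induction_on with
      | zero => simp
      | add a b ha hb => simp only [map_add, ha, hb]
      | tmul a b => simp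
    intro f
    rw [hΨa, liftLin_apply, key, hΔ']
    rfl
  have hg : ∀ i, lift y (Polynomial.aeval Ψ (eulerPoly K (d i)) (var K i)) =
      Polynomial.aeval (square K Unit) (eulerPoly K (d i)) (y i) := fun i => by
    rw [← liftLin_apply, aeval_apply_of_intertwines hΨy, liftLin_apply, lift_var]
  refine ⟨fun i => Polynomial.aeval Ψ (eulerPoly K (d i)) (var K i), fun i t ht => ?_,
    fun i => ?_, fun i => ?_⟩
  · rcases deg_le_one ht with rfl | ⟨x, rfl⟩
    · have h1 : ∀ f, coeffAt K 1 (Ψ f) = ((1 : K) • (1 : Module.End K K)) (coeffAt K 1 f) := by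
        intro f
        simp [hΨa, coeff_one_mul', hL]
      rw [← coeffAt_apply, aeval_apply_of_intertwines h1, coeffAt_apply, coeff_one_var, map_zero]
    -- On linear coefficients Ψ is multiplication by 2, where the polynomial has the value 1.
    · have h1 : ∀ f, coeffAt K ((FreeMagma.of x : FreeMagma ℕ) : Tree₁ ℕ) (Ψ f) =
          ((2 : K) • (1 : Module.End K K))
            (coeffAt K ((FreeMagma.of x : FreeMagma ℕ) : Tree₁ ℕ) f) := by
        intro f
        simp [hΨa, coeff_var_mul', hL, hR, two_mul]
      rw [← coeffAt_apply, aeval_apply_of_intertwines h1, aeval_smul_id, eulerPoly_eval_two,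
        one_smul, coeffAt_apply]
  · rw [hg]
    exact aeval_square_isHomogeneous _ (h.homogeneous i)
  · rw [hg]
    exact (isPrimitive_eulerPoly_and_mem_span (h.degree_pos i) (h.homogeneous i)).1

theorem bijective_of_strict (h : IsGradedFreeGenSeq y d) {g : ℕ → MagAlg K ℕ}
    (hg : ∀ i (t : Tree₁ ℕ), deg t ≤ 1 → (g i).coeff t = (var K i).coeff t)
    (hgh : ∀ i, IsHomogeneous (lift y (g i)) (d i)) : Function.Bijective (liftLin g) :=
  ⟨lift_injective_of_strict hg, lift_surjective_of_strict hg h.degree_pos fun i =>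
    mem_treeSpan_wdeg_of_isHomogeneous_lift h (hgh i)⟩

/-- φ is the inverse of the substitution g of `exists_strict_primitive`. That g carries Δ to Δ'
needs checking only on variables and after ε ⊗ ε, where it says that the ε(gᵢ) are primitive. -/
theorem exists_strict_automorphism [CharZero K] (h : IsGradedFreeGenSeq y d)
    {Δ' : MagAlg K ℕ →ₙₐ[K] MagAlg K ℕ ⊗[K] MagAlg K ℕ} (hΔ' : IsRestrictedCoadd y Δ') :
    ∃ φ : MagAlg K ℕ ≃ₗ[K] MagAlg K ℕ, φ 1 = 1 ∧ (∀ f g, φ (f * g) = φ f * φ g) ∧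
      IsStrict φ.toLinearMap ∧ ∀ f, coadd K ℕ f =
        TensorProduct.map φ.toLinearMap φ.toLinearMap (Δ' (φ.symm f)) := by
  rw [isRestrictedCoadd_iff] at hΔ'
  obtain ⟨g, hg, hgh, hgp⟩ := exists_strict_primitive h
  set ψ := LinearEquiv.ofBijective (liftLin g) (bijective_of_strict h hg hgh) with hψ
  have hψa : ∀ f, ψ f = lift g f := fun f => rfl
  have hinj := tensorMap_liftLin_injective (y := y) h.injective
  refine ⟨ψ.symm, ?_, fun a b => ?_, fun x t ht => ?_, fun f => ?_⟩
  · rw [LinearEquiv.symm_apply_eq, hψa, lift_one]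
  · rw [LinearEquiv.symm_apply_eq, hψa, map_mul, ← hψa, ← hψa]
    simp
  · have := coeff_lift_of_strict hg (ψ.symm (var K x)) ht
    rw [← hψa, LinearEquiv.apply_symm_apply] at this
    exact this.symm
  · have key : TensorProduct.map (liftLin g) (liftLin g) ∘ₗ coaddLin K ℕ =
        (Δ' : MagAlg K ℕ →ₗ[K] MagAlg K ℕ ⊗[K] MagAlg K ℕ) ∘ₗ liftLin g := by
      apply linearMap_ext_of_mul (B := MagAlg K ℕ ⊗[K] MagAlg K ℕ)
      · intro a b
        simp only [LinearMap.comp_apply, coaddLin_apply, map_mul, tensorMap_liftLin_mul]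
      · intro a b
        change Δ' (lift g (a * b)) = Δ' (lift g a) * Δ' (lift g b)
        rw [map_mul, map_mul]
      · apply hinj
        change _ = TensorProduct.map (liftLin y) (liftLin y) (Δ' (lift g 1))
        rw [hΔ']
        simp [coadd_one, lift_one]
      · intro x
        apply hinj
        change _ = TensorProduct.map (liftLin y) (liftLin y) (Δ' (lift g (var K x)))
        rw [hΔ', lift_var, hgp x]
        simp [coadd_var, lift_one, lift_var]
    have h2 := LinearMap.congr_fun key f
    change TensorProduct.map (liftLin g) (liftLin g) (coadd K ℕ f) = Δ' (ψ f) at h2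
    rw [LinearEquiv.symm_symm, ← h2, ← LinearMap.comp_apply, ← TensorProduct.map_comp]
    have h3 : ψ.symm.toLinearMap ∘ₗ liftLin g = LinearMap.id :=
      LinearMap.ext fun a => ψ.symm_apply_apply a
    rw [h3, TensorProduct.map_id, LinearMap.id_apply]

theorem exists_primitive_gradedFreeGenSeq [CharZero K] (h : IsGradedFreeGenSeq y d) :
    ∃ z : ℕ → MagAlg K Unit, IsGradedFreeGenSeq z d ∧ ∀ i, IsPrimitive (z i) := by
  obtain ⟨g, hg, hgh, hgp⟩ := exists_strict_primitive h
  have hb := bijective_of_strict h hg hgh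
  have hz : liftLin (fun i => lift y (g i)) = liftLin y ∘ₗ liftLin g := by
    apply linearMap_ext_of_mul
    · intro a b; simp
    · intro a b; simp
    · simp [lift_one]
    · intro x; simp [lift_var]
  have hz' : ∀ f, lift (fun i => lift y (g i)) f = lift y (lift g f) := LinearMap.congr_fun hz
  have hz2 : (⇑(lift fun i => lift y (g i) : MagAlg K ℕ →ₙₐ[K] MagAlg K Unit)) =
      (lift y : MagAlg K ℕ →ₙₐ[K] MagAlg K Unit) ∘ liftLin g := funext hz'
  refine ⟨fun i => lift y (g i), ⟨?_, ?_, hgh, h.monotone⟩, hgp⟩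
  · rw [hz2]; exact h.injective.comp hb.1
  · rw [hz2, Set.range_comp, hb.2.range_eq, Set.image_univ, h.range_eq]

end GradedFreeGenSeq

/-! ### The Taylor projection onto the constants -/

section ConstProj

variable {K : Type*} [Field K]

/-- The tree with a single leaf. -/
abbrev leaf : Tree₁ Unit := ((FreeMagma.of () : FreeMagma Unit) : Tree₁ Unit)

/-- Right multiplication by the variable. -/
noncomputable def mulVar (K : Type*) [Field K] : Module.End K (MagAlg K Unit) :=
  LinearMap.mulRight K (var K ())

theorem mulVar_apply (f : MagAlg K Unit) : mulVar K f = f * var K () := rfl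

theorem mulVar_mon (t : Tree₁ Unit) : mulVar K (mon K t) = mon K (t * leaf) :=
  mon_mul_mon t leaf

theorem ddx_mulVar (f : MagAlg K Unit) : ddx K (mulVar K f) = mulVar K (ddx K f) + f := by
  simp [mulVar_apply, ddx_mul, ddx_var]

theorem ddx_mulVar_pow (n : ℕ) (f : MagAlg K Unit) :
    ddx K ((mulVar K ^ (n + 1)) f) =
      (mulVar K ^ (n + 1)) (ddx K f) + ((n : K) + 1) • (mulVar K ^ n) f := by
  induction n with
  | zero => simp [ddx_mulVar]
  | succ n ih =>
    rw [pow_succ', Module.End.mul_apply, ddx_mulVar, ih, map_add, map_smul,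
      ← Module.End.mul_apply (mulVar K) (mulVar K ^ n), ← pow_succ',
      ← Module.End.mul_apply (mulVar K) (mulVar K ^ (n + 1)) (ddx K f), ← pow_succ']
    push_cast
    module

theorem ddx_pow_mulVar (n : ℕ) (f : MagAlg K Unit) :
    (ddx K ^ (n + 1)) (mulVar K f) =
      mulVar K ((ddx K ^ (n + 1)) f) + ((n : K) + 1) • (ddx K ^ n) f := by
  induction n with
  | zero => simp [ddx_mulVar]
  | succ n ih =>
    rw [pow_succ', Module.End.mul_apply, ih, map_add, map_smul, ddx_mulVar,
      ← Module.End.mul_apply (ddx K) (ddx K ^ n), ← pow_succ',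
      ← Module.End.mul_apply (ddx K) (ddx K ^ (n + 1)) f, ← pow_succ']
    push_cast
    module

theorem ddx_mon_mem (t : Tree₁ Unit) : ddx K (mon K t) ∈ treeSpan K {s | deg s + 1 = deg t} := by
  induction t using tree_induction with
  | one => rw [mon_one, ddx_one]; exact zero_mem _
  | of x =>
    change ddx K (var K ()) ∈ _
    rw [ddx_var]
    exact mon_mem_treeSpan (t := 1) rfl
  | mul s t hs ht =>
    have hs' : mon K (s : Tree₁ Unit) ∈ treeSpan K {r | deg r = deg (s : Tree₁ Unit)} :=
      mon_mem_treeSpan rfl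
    have ht' : mon K (t : Tree₁ Unit) ∈ treeSpan K {r | deg r = deg (t : Tree₁ Unit)} :=
      mon_mem_treeSpan rfl
    rw [← mon_mul_mon, ddx_mul]
    refine add_mem (mul_mem_treeSpan ?_ hs ht') (mul_mem_treeSpan ?_ hs' ht)
    all_goals
      intro a ha b hb
      simp only [Set.mem_ofPred_eq, deg_mul] at *
      omega

theorem ddx_pow_mon_mem (k : ℕ) (t : Tree₁ Unit) :
    (ddx K ^ k) (mon K t) ∈ treeSpan K {s | deg s + k = deg t} := by
  induction k with
  | zero => exact mon_mem_treeSpan rfl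
  | succ k ih =>
    rw [pow_succ', Module.End.mul_apply]
    refine map_mem_of_mem_treeSpan ?_ ih
    intro s hs
    refine treeSpan_mono ?_ (ddx_mon_mem s)
    intro r hr
    simp only [Set.mem_ofPred_eq] at *
    omega

theorem ddx_pow_mon_eq_zero {k : ℕ} {t : Tree₁ Unit} (h : deg t < k) :
    (ddx K ^ k) (mon K t) = 0 := by
  rw [← MonoidAlgebra.coeff_eq_zero]
  ext s
  by_contra hne
  have := mem_treeSpan.1 (ddx_pow_mon_mem k t) s hne
  simp only [Set.mem_ofPred_eq] at this
  omega

theorem exists_ddx_pow_eq_zero (f : MagAlg K Unit) : ∃ n, ∀ k, n ≤ k → (ddx K ^ k) f = 0 := by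
  induction f using MonoidAlgebra.induction_linear with
  | zero => exact ⟨0, by simp⟩
  | add f g hf hg =>
    obtain ⟨m, hm⟩ := hf
    obtain ⟨n, hn⟩ := hg
    exact ⟨m + n, fun k hk => by rw [map_add, hm k (by omega), hn k (by omega), add_zero]⟩
  | single t c =>
    refine ⟨deg t + 1, fun k hk => ?_⟩
    have : MonoidAlgebra.single t c = c • mon K t := by simp [mon]
    rw [this, map_smul, ddx_pow_mon_eq_zero (by omega), smul_zero]

/-- The terms of the alternating Taylor series. -/
noncomputable def taylorTerm (K : Type*) [Field K] (k : ℕ) : Module.End K (MagAlg K Unit) :=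
  ((-1) ^ k / (k.factorial : K)) • (mulVar K ^ k * ddx K ^ k)

theorem taylorTerm_apply (k : ℕ) (f : MagAlg K Unit) :
    taylorTerm K k f =
      ((-1) ^ k / (k.factorial : K)) • (mulVar K ^ k) ((ddx K ^ k) f) := rfl

theorem taylorTerm_zero (f : MagAlg K Unit) : taylorTerm K 0 f = f := by
  simp [taylorTerm_apply]

theorem taylor_coeff_succ [CharZero K] (k : ℕ) :
    (-1) ^ (k + 1) / ((k + 1).factorial : K) * ((k : K) + 1) =
      -((-1) ^ k / (k.factorial : K)) := by
  have h1 : ((k : K) + 1) ≠ 0 := by exact_mod_cast k.succ_ne_zero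
  have h2 : (k.factorial : K) ≠ 0 := by exact_mod_cast k.factorial_ne_zero
  rw [Nat.factorial_succ]
  push_cast
  field_simp
  ring

/-- The projection `f ↦ ∑ (-1)ᵏ/k! (…(f⁽ᵏ⁾ x)…) x` of `K{x}` onto the algebra of constants. -/
noncomputable def constProj (K : Type*) [Field K] : MagAlg K Unit →ₗ[K] MagAlg K Unit :=
  (monBasis K Unit).constr K fun t =>
    ∑ k ∈ Finset.range (deg t + 1), taylorTerm K k (mon K t)

theorem constProj_mon (t : Tree₁ Unit) {n : ℕ} (hn : deg t < n) :
    constProj K (mon K t) = ∑ k ∈ Finset.range n, taylorTerm K k (mon K t) := by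
  have h1 : constProj K (mon K t) =
      ∑ k ∈ Finset.range (deg t + 1), taylorTerm K k (mon K t) :=
    (monBasis K Unit).constr_basis K _ t
  rw [h1]
  refine Finset.sum_subset (Finset.range_subset_range.2 hn) fun k _ hk => ?_
  rw [taylorTerm_apply, ddx_pow_mon_eq_zero (by simpa using hk), map_zero, smul_zero]

theorem exists_constProj_eq_sum (f : MagAlg K Unit) :
    ∃ n, ∀ m, n ≤ m → constProj K f = ∑ k ∈ Finset.range m, taylorTerm K k f := by
  induction f using MonoidAlgebra.induction_linear with
  | zero => exact ⟨0, by simp⟩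
  | add f g hf hg =>
    obtain ⟨a, ha⟩ := hf
    obtain ⟨b, hb⟩ := hg
    refine ⟨a + b, fun k hk => ?_⟩
    simp only [map_add, ha k (by omega), hb k (by omega), Finset.sum_add_distrib]
  | single t c =>
    refine ⟨deg t + 1, fun k hk => ?_⟩
    have : MonoidAlgebra.single t c = c • mon K t := by simp [mon]
    simp only [this, map_smul, constProj_mon t (show deg t < k by omega), Finset.smul_sum]

/-- All terms of the Taylor sum but the zeroth are right multiples of x. -/
theorem constProj_eq_add_mulVar (f : MagAlg K Unit) :
    ∃ h, constProj K f = f + mulVar K h := by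
  obtain ⟨n, hn⟩ := exists_constProj_eq_sum f
  rw [hn (n + 1) (by omega), Finset.sum_range_succ', taylorTerm_zero, add_comm]
  refine ⟨∑ k ∈ Finset.range n, ((-1) ^ (k + 1) / ((k + 1).factorial : K)) •
    (mulVar K ^ k) ((ddx K ^ (k + 1)) f), ?_⟩
  rw [map_sum]
  congr 1
  refine Finset.sum_congr rfl fun k _ => ?_
  rw [taylorTerm_apply, map_smul, pow_succ' (mulVar K), Module.End.mul_apply]

theorem constProj_of_ddx_eq_zero {f : MagAlg K Unit} (hf : ddx K f = 0) : constProj K f = f := by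
  obtain ⟨n, hn⟩ := exists_constProj_eq_sum f
  rw [hn (n + 1) (by omega), Finset.sum_range_succ', taylorTerm_zero,
    Finset.sum_eq_zero fun k _ => ?_, zero_add]
  rw [taylorTerm_apply, pow_succ (ddx K), Module.End.mul_apply, hf, map_zero, map_zero, smul_zero]

theorem ddx_constProj [CharZero K] (f : MagAlg K Unit) : ddx K (constProj K f) = 0 := by
  -- The derivatives telescope; the remaining term vanishes for large n as d/dx is locally
  -- nilpotent.
  have key : ∀ n, ddx K (∑ k ∈ Finset.range (n + 1), taylorTerm K k f) =
      ((-1) ^ n / (n.factorial : K)) • (mulVar K ^ n) ((ddx K ^ (n + 1)) f) := by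
    intro n
    induction n with
    | zero => simp [taylorTerm_zero]
    | succ n ih =>
      rw [Finset.sum_range_succ, map_add, ih, taylorTerm_apply, map_smul, ddx_mulVar_pow, smul_add,
        smul_smul, taylor_coeff_succ, ← Module.End.mul_apply (ddx K) (ddx K ^ (n + 1)), ← pow_succ']
      module
  obtain ⟨n, hn⟩ := exists_constProj_eq_sum f
  obtain ⟨m, hm⟩ := exists_ddx_pow_eq_zero f
  rw [hn (n + m + 1) (by omega), key, hm _ (by omega), map_zero, smul_zero]

/-- The same telescoping, now with the commutator of multiplication by x and powers of d/dx. With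
`constProj_eq_add_mulVar`, the kernel is exactly the right multiples of x. -/
theorem constProj_mulVar [CharZero K] (f : MagAlg K Unit) : constProj K (mulVar K f) = 0 := by
  have key : ∀ n, ∑ k ∈ Finset.range (n + 1), taylorTerm K k (mulVar K f) =
      ((-1) ^ n / (n.factorial : K)) • (mulVar K ^ (n + 1)) ((ddx K ^ n) f) := by
    intro n
    induction n with
    | zero => simp [taylorTerm_zero]
    | succ n ih =>
      rw [Finset.sum_range_succ, ih, taylorTerm_apply, ddx_pow_mulVar, map_add, map_smul, smul_add,
        smul_smul, taylor_coeff_succ, ← Module.End.mul_apply (mulVar K ^ (n + 1)) (mulVar K),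
        ← pow_succ]
      module
  obtain ⟨n, hn⟩ := exists_constProj_eq_sum (mulVar K f)
  obtain ⟨m, hm⟩ := exists_ddx_pow_eq_zero f
  rw [hn (n + m + 1) (by omega), key, hm _ (by omega), map_zero, smul_zero]

theorem constProj_mon_isHomogeneous (t : Tree₁ Unit) :
    IsHomogeneous (constProj K (mon K t)) (deg t) := by
  have key : ∀ (k n : ℕ) {f : MagAlg K Unit}, f ∈ treeSpan K {s | deg s + k = n} →
      (mulVar K ^ k) f ∈ treeSpan K {s | deg s = n} := by
    intro k n
    induction k with
    | zero => exact fun h => h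
    | succ k ih =>
      intro f hf
      rw [pow_succ, Module.End.mul_apply]
      refine ih (map_mem_of_mem_treeSpan ?_ hf)
      intro s hs
      rw [mulVar_mon]
      refine mon_mem_treeSpan ?_
      simp only [Set.mem_ofPred_eq, deg_mul, deg_of] at *
      omega
  rw [isHomogeneous_iff, constProj_mon t (Nat.lt_succ_self _)]
  refine sum_mem fun k _ => ?_
  rw [taylorTerm_apply]
  exact Submodule.smul_mem _ _ (key k _ (ddx_pow_mon_mem k t))

theorem constProj_one : constProj K 1 = 1 := constProj_of_ddx_eq_zero ddx_one

/-- The tree is a product with the variable on the right. -/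
def EndsInVar (t : Tree₁ Unit) : Prop := ∃ u, t = u * leaf

theorem constProj_mon_eq_zero [CharZero K] {t : Tree₁ Unit} (h : EndsInVar t) :
    constProj K (mon K t) = 0 := by
  obtain ⟨u, rfl⟩ := h
  rw [← mulVar_mon, constProj_mulVar]

theorem coeff_mulVar {t : Tree₁ Unit} (h : ¬ EndsInVar t) (f : MagAlg K Unit) :
    (mulVar K f).coeff t = 0 := by
  have h1 : mulVar K f ∈ treeSpan K {t | EndsInVar t} := by
    refine map_mem_of_mem_treeSpan (fun s _ => ?_) (mem_treeSpan_univ f)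
    rw [mulVar_mon]
    exact mon_mem_treeSpan ⟨s, rfl⟩
  by_contra hne
  exact h (mem_treeSpan.1 h1 t hne)

theorem coeff_constProj {t : Tree₁ Unit} (h : ¬ EndsInVar t) (f : MagAlg K Unit) :
    (constProj K f).coeff t = f.coeff t := by
  obtain ⟨g, hg⟩ := constProj_eq_add_mulVar f
  rw [hg, MonoidAlgebra.coeff_add, Finsupp.add_apply, coeff_mulVar h, add_zero]

theorem not_endsInVar_one : ¬ EndsInVar 1 := by
  rintro ⟨u, hu⟩
  have := congrArg deg hu
  rw [deg_mul, deg_one, deg_of] at this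
  omega

theorem endsInVar_leaf : EndsInVar leaf := ⟨1, (one_mul _).symm⟩

end ConstProj

/-! ### Cutting trees at the root -/

section Ungraft

variable {K X : Type*} [Field K]

theorem tree_mul_injective {s t s' t' : FreeMagma X}
    (h : (s : Tree₁ X) * (t : Tree₁ X) = (s' : Tree₁ X) * (t' : Tree₁ X)) : s = s' ∧ t = t' := by
  rw [← WithOne.coe_mul, ← WithOne.coe_mul, WithOne.coe_inj] at h
  change FreeMagma.mul s t = FreeMagma.mul s' t' at h
  injection h with h₁ h₂
  exact ⟨h₁, h₂⟩

theorem tree_mul_ne_of (s t : FreeMagma X) (x : X) :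
    (s : Tree₁ X) * (t : Tree₁ X) ≠ ((FreeMagma.of x : FreeMagma X) : Tree₁ X) := by
  intro h
  have := congrArg deg h
  have := deg_coe_pos s
  have := deg_coe_pos t
  rw [deg_mul, deg_of] at *
  omega

theorem tree_mul_ne_one (s t : FreeMagma X) : (s : Tree₁ X) * (t : Tree₁ X) ≠ 1 := by
  rw [← WithOne.coe_mul]
  exact WithOne.coe_ne_one

/-- The linear map `s * t ↦ s ⊗ t` that decomposes the trees at their roots. -/
noncomputable def ungraft (K X : Type*) [Field K] : MagAlg K X →ₗ[K] MagAlg K X ⊗[K] MagAlg K X :=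
  (monBasis K X).constr K fun t => WithOne.recOneCoe 0
    (FreeMagma.rec (fun _ => 0) fun s t _ _ => mon K (s : Tree₁ X) ⊗ₜ mon K (t : Tree₁ X)) t

theorem ungraft_one : ungraft K X 1 = 0 := (monBasis K X).constr_basis K _ 1

theorem ungraft_var (x : X) : ungraft K X (var K x) = 0 :=
  (monBasis K X).constr_basis K _ _

theorem ungraft_mon_mul (s t : FreeMagma X) :
    ungraft K X (mon K ((s : Tree₁ X) * (t : Tree₁ X))) =
      mon K (s : Tree₁ X) ⊗ₜ mon K (t : Tree₁ X) :=
  (monBasis K X).constr_basis K _ _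

theorem mem_treeSpan_ne_one {f : MagAlg K X} (hf : f.coeff 1 = 0) :
    f ∈ treeSpan K {t : Tree₁ X | t ≠ 1} :=
  mem_treeSpan.2 fun _ ht h => ht (h ▸ hf)

/-- Constant terms are excluded because a product with the empty tree does not create a root. -/
theorem ungraft_mul {f g : MagAlg K X} (hf : f.coeff 1 = 0) (hg : g.coeff 1 = 0) :
    ungraft K X (f * g) = f ⊗ₜ g := by
  have h1 : ∀ s ∈ {t : Tree₁ X | t ≠ 1}, ∀ g ∈ treeSpan K {t : Tree₁ X | t ≠ 1},
      ungraft K X (mon K s * g) - mon K s ⊗ₜ g = 0 := by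
    intro s hs g hg
    refine (Submodule.mem_bot K).1 (map_mem_of_mem_treeSpan
      (L := ungraft K X ∘ₗ LinearMap.mulLeft K (mon K s) - TensorProduct.mk K _ _ (mon K s)) ?_ hg)
    intro t ht
    lift s to FreeMagma X using hs
    lift t to FreeMagma X using ht
    simp [mon_mul_mon, ungraft_mon_mul]
  refine sub_eq_zero.1 ((Submodule.mem_bot K).1 (map_mem_of_mem_treeSpan
    (L := ungraft K X ∘ₗ LinearMap.mulRight K g - (TensorProduct.mk K _ _).flip g) ?_
    (mem_treeSpan_ne_one hf)))
  intro s hs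
  exact (Submodule.mem_bot K).2 (h1 s hs g (mem_treeSpan_ne_one hg))

end Ungraft

/-! ### Free generators of the algebra of constants -/

section Generators

variable {K : Type*} [Field K]

/-- The trees `s * t`, `t ≠ x`, such that `s` or `t` is a product with the variable `x` on the
right. -/
def IsGenTree (t : Tree₁ Unit) : Prop :=
  ∃ s r : FreeMagma Unit, t = (s : Tree₁ Unit) * (r : Tree₁ Unit) ∧ (r : Tree₁ Unit) ≠ leaf ∧
    (EndsInVar s ∨ EndsInVar r)

theorem endsInVar_mul {s r : FreeMagma Unit}
    (h : EndsInVar ((s : Tree₁ Unit) * (r : Tree₁ Unit))) : (r : Tree₁ Unit) = leaf := by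
  obtain ⟨u, hu⟩ := h
  induction u using WithOne.recOneCoe with
  | one => exact absurd (hu.trans (one_mul _)) (tree_mul_ne_of s r ())
  | coe u => rw [(tree_mul_injective hu).2]

theorem IsGenTree.not_endsInVar {t : Tree₁ Unit} (h : IsGenTree t) : ¬ EndsInVar t := by
  obtain ⟨s, r, rfl, hr, -⟩ := h
  exact fun h => hr (endsInVar_mul h)

theorem IsGenTree.ne_one {t : Tree₁ Unit} (h : IsGenTree t) : t ≠ 1 := by
  obtain ⟨s, r, rfl, -⟩ := h
  exact tree_mul_ne_one s r

/-- The linear map that decomposes the trees at their roots and projects both factors to the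
constants. -/
noncomputable def constUngraft (K : Type*) [Field K] :
    MagAlg K Unit →ₗ[K] MagAlg K Unit ⊗[K] MagAlg K Unit :=
  TensorProduct.map (constProj K) (constProj K) ∘ₗ ungraft K Unit

theorem constUngraft_one : constUngraft K 1 = 0 := by simp [constUngraft, ungraft_one]

theorem constUngraft_mon_mul (s t : FreeMagma Unit) :
    constUngraft K (mon K ((s : Tree₁ Unit) * (t : Tree₁ Unit))) =
      constProj K (mon K (s : Tree₁ Unit)) ⊗ₜ constProj K (mon K (t : Tree₁ Unit)) := by
  simp [constUngraft, ungraft_mon_mul]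

theorem constUngraft_mul {f g : MagAlg K Unit} (hf : ddx K f = 0) (hg : ddx K g = 0)
    (hf1 : f.coeff 1 = 0) (hg1 : g.coeff 1 = 0) : constUngraft K (f * g) = f ⊗ₜ g := by
  simp [constUngraft, ungraft_mul hf1 hg1, constProj_of_ddx_eq_zero hf,
    constProj_of_ddx_eq_zero hg]

theorem ddx_lift {ι : Type*} {y : ι → MagAlg K Unit} (hy : ∀ i, ddx K (y i) = 0) (f : MagAlg K ι) :
    ddx K (lift y f) = 0 := by
  refine map_mem_of_mem_treeSpan (L := liftLin y) (N := LinearMap.ker (ddx K)) ?_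
    (mem_treeSpan_univ f)
  intro t _
  rw [LinearMap.mem_ker, liftLin_apply]
  induction t using tree_induction with
  | one => rw [mon_one, lift_one, ddx_one]
  | of i =>
    change ddx K (lift y (var K i)) = 0
    rw [lift_var, hy]
  | mul s t hs ht => rw [← mon_mul_mon, map_mul, ddx_mul, hs trivial, ht trivial]; simp

theorem coeff_one_constProj (f : MagAlg K Unit) : (constProj K f).coeff 1 = f.coeff 1 :=
  coeff_constProj not_endsInVar_one f

/-- The projection leaves the coefficients of trees not ending in x unchanged, so such coefficients
can be read off after projecting both factors. -/
theorem coeff_mul_eq_of_constUngraft {s r : FreeMagma Unit} (hs : ¬ EndsInVar s)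
    (hr : ¬ EndsInVar r) (f : MagAlg K Unit) :
    f.coeff ((s : Tree₁ Unit) * (r : Tree₁ Unit)) =
      LinearMap.mul' K K (TensorProduct.map (coeffAt K (s : Tree₁ Unit))
        (coeffAt K (r : Tree₁ Unit)) (constUngraft K f)) := by
  have : coeffAt K ((s : Tree₁ Unit) * (r : Tree₁ Unit)) = LinearMap.mul' K K ∘ₗ
      TensorProduct.map (coeffAt K (s : Tree₁ Unit)) (coeffAt K (r : Tree₁ Unit)) ∘ₗ
        constUngraft K := by
    classical
    refine linearMap_ext_mon fun t => ?_
    simp only [LinearMap.comp_apply]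
    induction t using tree_induction with
    | one =>
      rw [mon_one, constUngraft_one, map_zero, map_zero, ← mon_one, coeffAt_apply, coeff_mon,
        if_neg (tree_mul_ne_one s r).symm]
    | of x =>
      have : constUngraft K (mon K ((FreeMagma.of x : FreeMagma Unit) : Tree₁ Unit)) = 0 := by
        change constUngraft K (var K x) = 0
        rw [constUngraft, LinearMap.comp_apply, ungraft_var, map_zero]
      rw [this, map_zero, map_zero, coeffAt_apply, coeff_mon, if_neg (tree_mul_ne_of s r x).symm]
    | mul a b _ _ =>
      rw [constUngraft_mon_mul, TensorProduct.map_tmul, LinearMap.mul'_apply]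
      simp only [coeffAt_apply, coeff_constProj hs, coeff_constProj hr, coeff_mon]
      by_cases h : a = s ∧ b = r
      · rw [h.1, h.2]; simp
      · rw [if_neg fun h' => h (tree_mul_injective h'), ite_zero_mul_ite_zero, if_neg]
        simpa [WithOne.coe_inj] using h
  exact LinearMap.congr_fun this f

variable [CharZero K]

/-- The right factor x projects to 0. Hence `constUngraft` does not see the correction made by
`constProj`. -/
theorem constUngraft_mulVar (f : MagAlg K Unit) : constUngraft K (mulVar K f) = 0 := by
  have : constUngraft K ∘ₗ mulVar K = 0 := by
    refine linearMap_ext_mon fun t => ?_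
    rw [LinearMap.comp_apply, mulVar_mon, LinearMap.zero_apply]
    induction t using WithOne.recOneCoe with
    | one =>
      rw [one_mul]
      change constUngraft K (var K ()) = 0
      rw [constUngraft, LinearMap.comp_apply, ungraft_var, map_zero]
    | coe t =>
      rw [constUngraft_mon_mul, constProj_mon_eq_zero endsInVar_leaf, TensorProduct.tmul_zero]
  exact LinearMap.congr_fun this f

theorem constUngraft_constProj (f : MagAlg K Unit) :
    constUngraft K (constProj K f) = constUngraft K f := by
  obtain ⟨h, hh⟩ := constProj_eq_add_mulVar f
  rw [hh, map_add, constUngraft_mulVar, add_zero]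

theorem constUngraft_genTree {t : Tree₁ Unit} (h : IsGenTree t) :
    constUngraft K (mon K t) = 0 := by
  obtain ⟨s, r, rfl, -, hs | hr⟩ := h
  · rw [constUngraft_mon_mul, constProj_mon_eq_zero hs, TensorProduct.zero_tmul]
  · rw [constUngraft_mon_mul, constProj_mon_eq_zero hr, TensorProduct.tmul_zero]

/-- A constant that does not have a decomposable part is a linear combination of generators. -/
theorem mem_span_of_constUngraft_eq_zero {f : MagAlg K Unit} (hf : ddx K f = 0)
    (h1 : f.coeff 1 = 0) (h : constUngraft K f = 0) :
    f ∈ Submodule.span K ((fun t => constProj K (mon K t)) '' {t | IsGenTree t}) := by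
  rw [← constProj_of_ddx_eq_zero hf]
  refine map_mem_of_mem_treeSpan (S := {t | f.coeff t ≠ 0}) ?_ (mem_treeSpan.2 fun _ h => h)
  intro t ht
  by_cases he : EndsInVar t
  · rw [constProj_mon_eq_zero he]; exact zero_mem _
  by_cases hg : IsGenTree t
  · exact Submodule.subset_span ⟨t, hg, rfl⟩
  -- What remains are the products of two trees not ending in x; their coefficients are determined
  -- by `constUngraft K f`, which is zero.
  exfalso
  induction t using tree_induction with
  | one => exact ht h1
  | of x => exact he endsInVar_leaf
  | mul s r _ _ =>
    have hr : (r : Tree₁ Unit) ≠ leaf := fun h => he ⟨s, by rw [h]⟩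
    have h2 : ¬ (EndsInVar s ∨ EndsInVar r) := fun h => hg ⟨s, r, rfl, hr, h⟩
    push Not at h2
    refine ht ?_
    rw [coeff_mul_eq_of_constUngraft h2.1 h2.2, h, map_zero, map_zero]

variable {ι : Type*} {gen : ι → Tree₁ Unit}

/-- Linear forms dual to the images of the trees in K{Y} are built by recursion on the tree:
`constUngraft` kills the generators and splits products into their two factors. -/
theorem lift_constProj_injective (hinj : Function.Injective gen) (hgen : ∀ i, IsGenTree (gen i)) :
    Function.Injective (lift (fun i => constProj K (mon K (gen i))) :
      MagAlg K ι →ₙₐ[K] MagAlg K Unit) := by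
  classical
  set y : ι → MagAlg K Unit := fun i => constProj K (mon K (gen i)) with hy
  have hd : ∀ f, ddx K (lift y f) = 0 := ddx_lift fun i => ddx_constProj _
  have hc : ∀ f : MagAlg K ι, (lift y f).coeff 1 = f.coeff 1 := coeff_one_lift fun i => by
    rw [hy, coeff_one_constProj, coeff_mon, if_neg (hgen i).ne_one]
  have hvar : ∀ i, lift y (mon K ((FreeMagma.of i : FreeMagma ι) : Tree₁ ι)) = y i := lift_var y
  have hβv : ∀ i, constUngraft K (y i) = 0 := fun i => by
    rw [hy, constUngraft_constProj, constUngraft_genTree (hgen i)]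
  have hβm : ∀ s t : FreeMagma ι,
      constUngraft K (lift y (mon K (s : Tree₁ ι)) * lift y (mon K (t : Tree₁ ι))) =
        lift y (mon K (s : Tree₁ ι)) ⊗ₜ lift y (mon K (t : Tree₁ ι)) := fun s t =>
    constUngraft_mul (hd _) (hd _) (by rw [hc, coeff_mon, if_neg WithOne.coe_ne_one])
      (by rw [hc, coeff_mon, if_neg WithOne.coe_ne_one])
  have key : ∀ t : Tree₁ ι, ∃ l : MagAlg K Unit →ₗ[K] K,
      ∀ s, l (lift y (mon K s)) = if s = t then 1 else 0 := by
    intro t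
    induction t using tree_induction with
    | one => exact ⟨coeffAt K 1, fun s => by rw [coeffAt_apply, hc, coeff_mon]⟩
    | of i =>
      -- The bracket kills products of images and fixes generators, which are then separated by the
      -- coefficient at `gen i`.
      refine ⟨coeffAt K (gen i) ∘ₗ (LinearMap.id - LinearMap.mul' K _ ∘ₗ constUngraft K),
        fun s => ?_⟩
      simp only [LinearMap.comp_apply, LinearMap.sub_apply, LinearMap.id_apply]
      induction s using tree_induction with
      | one =>
        rw [mon_one, lift_one, constUngraft_one, map_zero, sub_zero, ← mon_one, coeffAt_apply,
          coeff_mon, if_neg (hgen i).ne_one.symm, if_neg WithOne.one_ne_coe]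
      | of j =>
        rw [hvar, hβv, map_zero, sub_zero, coeffAt_apply, hy,
          coeff_constProj (hgen i).not_endsInVar, coeff_mon]
        refine if_congr (hinj.eq_iff.trans ?_) rfl rfl
        rw [WithOne.coe_inj]
        exact ⟨fun h => by rw [h], fun h => by injection h⟩
      | mul a b _ _ =>
        rw [← mon_mul_mon, map_mul, hβm, LinearMap.mul'_apply, sub_self, map_zero,
          if_neg (tree_mul_ne_of a b i)]
    | mul a b ha hb =>
      obtain ⟨la, hla⟩ := ha
      obtain ⟨lb, hlb⟩ := hb
      refine ⟨LinearMap.mul' K K ∘ₗ TensorProduct.map la lb ∘ₗ constUngraft K, fun s => ?_⟩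
      simp only [LinearMap.comp_apply]
      induction s using tree_induction with
      | one =>
        rw [mon_one, lift_one, constUngraft_one, map_zero, map_zero,
          if_neg (tree_mul_ne_one a b).symm]
      | of j => rw [hvar, hβv, map_zero, map_zero, if_neg (tree_mul_ne_of a b j).symm]
      | mul c e _ _ =>
        rw [← mon_mul_mon, map_mul, hβm, TensorProduct.map_tmul, LinearMap.mul'_apply, hla, hlb]
        by_cases h : c = a ∧ e = b
        · rw [h.1, h.2]; simp
        · rw [if_neg (c := (c : Tree₁ ι) * e = a * b) fun h' => h (tree_mul_injective h'),
            ite_zero_mul_ite_zero, if_neg]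
          simpa [WithOne.coe_inj] using h
  refine (injective_iff_map_eq_zero (liftLin y)).2 fun f hf => ?_
  rw [← MonoidAlgebra.coeff_eq_zero]
  ext t
  obtain ⟨l, hl⟩ := key t
  have : l ∘ₗ liftLin y = coeffAt K t := linearMap_ext_mon fun s => by
    rw [LinearMap.comp_apply, liftLin_apply, hl, coeffAt_apply, coeff_mon]
  rw [← coeffAt_apply, ← this, LinearMap.comp_apply, hf, map_zero, Finsupp.zero_apply]

theorem range_lift_constProj (hgen : ∀ t, IsGenTree t ↔ t ∈ Set.range gen) :
    Set.range (lift (fun i => constProj K (mon K (gen i))) : MagAlg K ι →ₙₐ[K] MagAlg K Unit) =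
      constants K := by
  classical
  set y : ι → MagAlg K Unit := fun i => constProj K (mon K (gen i)) with hy
  have hmul : ∀ {a b}, a ∈ LinearMap.range (liftLin y) → b ∈ LinearMap.range (liftLin y) →
      a * b ∈ LinearMap.range (liftLin y) := by
    rintro _ _ ⟨a, rfl⟩ ⟨b, rfl⟩
    exact ⟨a * b, lift_mul y a b⟩
  have hspan : Submodule.span K ((fun t => constProj K (mon K t)) '' {t | IsGenTree t}) ≤
      LinearMap.range (liftLin y) := by
    rw [Submodule.span_le]
    rintro _ ⟨t, ht, rfl⟩
    obtain ⟨i, rfl⟩ := (hgen t).1 ht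
    exact ⟨var K i, lift_var y i⟩
  have key : ∀ t : Tree₁ Unit, constProj K (mon K t) ∈ LinearMap.range (liftLin y) := by
    intro t
    induction t using tree_induction with
    | one => exact ⟨1, by rw [liftLin_apply, lift_one, mon_one, constProj_one]⟩
    | of x => exact (constProj_mon_eq_zero endsInVar_leaf (K := K)) ▸ zero_mem _
    | mul s r hs hr =>
      have hs1 : (constProj K (mon K (s : Tree₁ Unit))).coeff 1 = 0 := by
        rw [coeff_one_constProj, coeff_mon, if_neg WithOne.coe_ne_one]
      have hr1 : (constProj K (mon K (r : Tree₁ Unit))).coeff 1 = 0 := by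
        rw [coeff_one_constProj, coeff_mon, if_neg WithOne.coe_ne_one]
      -- Both terms have the same `constUngraft`, so their difference is a combination of
      -- generators.
      have h : constProj K (mon K ((s : Tree₁ Unit) * (r : Tree₁ Unit))) -
          constProj K (mon K (s : Tree₁ Unit)) * constProj K (mon K (r : Tree₁ Unit)) ∈
            LinearMap.range (liftLin y) := by
        refine hspan (mem_span_of_constUngraft_eq_zero ?_ ?_ ?_)
        · rw [map_sub, ddx_mul]; simp [ddx_constProj]
        · rw [MonoidAlgebra.coeff_sub, Finsupp.sub_apply, coeff_one_mul, hs1, coeff_one_constProj,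
            coeff_mon, if_neg (tree_mul_ne_one s r)]
          simp
        · rw [map_sub, constUngraft_constProj, constUngraft_mon_mul,
            constUngraft_mul (ddx_constProj _) (ddx_constProj _) hs1 hr1, sub_self]
      simpa using add_mem h (hmul hs hr)
  ext f
  constructor
  · rintro ⟨f, rfl⟩
    exact ddx_lift (fun i => ddx_constProj _) f
  · intro hf
    have := map_mem_of_mem_treeSpan (fun t _ => key t) (mem_treeSpan_univ f)
    rwa [constProj_of_ddx_eq_zero hf] at this

end Generators

/-! ### Enumerating the generators by degree -/

section Enumeration

/-- An infinite type with a grading that has finite fibres has an enumeration with nondecreasing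
degrees. -/
theorem exists_equiv_nat_monotone {α : Type*} [Infinite α] [Countable α] (f : α → ℕ)
    (hf : ∀ n, {a | f a ≤ n}.Finite) : ∃ e : ℕ ≃ α, Monotone (f ∘ e) := by
  obtain ⟨c, hc⟩ := exists_injective_nat α
  -- Ties in degree are broken by an arbitrary injection into ℕ; each element then has finitely many
  -- predecessors, and their number is its rank.
  set key : α → ℕ ×ₗ ℕ := fun a => toLex (f a, c a) with hkey
  have hkey_inj : Function.Injective key := fun a b h => hc (congrArg (fun p => (ofLex p).2) h)
  have hle : ∀ {a b}, key a ≤ key b → f a ≤ f b := by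
    intro a b h
    rcases Prod.Lex.le_iff.1 h with h | h
    · exact h.le
    · exact h.1.le
  have hfin : ∀ a, {b | key b < key a}.Finite := fun a => (hf (f a)).subset fun b hb => hle hb.le
  set r : α → ℕ := fun a => {b | key b < key a}.ncard with hr
  have hmono : ∀ {a b}, key a < key b → r a < r b := fun {a b} h =>
    Set.ncard_lt_ncard ⟨fun x hx => lt_trans hx h,
      fun hs => lt_irrefl (key a) (hs h : key a < key a)⟩ (hfin b)
  have hinj : Function.Injective r := by
    intro a b h
    rcases lt_trichotomy (key a) (key b) with h1 | h1 | h1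
    · exact absurd h (hmono h1).ne
    · exact hkey_inj h1
    · exact absurd h (hmono h1).ne'
  have : Infinite (Set.range r) := Set.infinite_coe_iff.2 (Set.infinite_range_of_injective hinj)
  refine ⟨(Nat.Subtype.orderIsoOfNat (Set.range r)).toEquiv.trans (Equiv.ofInjective r hinj).symm,
    fun i j hij => hle (le_of_not_gt fun h => (hmono h).not_ge ?_)⟩
  have h1 : ∀ k, r ((Equiv.ofInjective r hinj).symm (Nat.Subtype.orderIsoOfNat (Set.range r) k)) =
      Nat.Subtype.orderIsoOfNat (Set.range r) k := fun k =>
    Equiv.apply_ofInjective_symm hinj _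
  simp only [Equiv.trans_apply, RelIso.coe_fn_toEquiv, h1]
  exact (Nat.Subtype.orderIsoOfNat (Set.range r)).monotone hij

theorem finite_deg_le (n : ℕ) : {t : Tree₁ Unit | deg t ≤ n}.Finite := by
  induction n with
  | zero => exact (Set.finite_singleton 1).subset fun t ht => deg_eq_zero.1 (Nat.le_zero.1 ht)
  | succ n ih =>
    refine (((Set.finite_singleton 1).union (Set.finite_singleton leaf)).union
      (ih.image2 (fun s t => s * t) ih)).subset fun t ht => ?_
    induction t using tree_induction with
    | one => exact Or.inl (Or.inl rfl)
    | of x => exact Or.inl (Or.inr rfl)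
    | mul s t _ _ =>
      have := deg_coe_pos s
      have := deg_coe_pos t
      simp only [Set.mem_ofPred_eq, deg_mul] at ht
      exact Or.inr ⟨s, show deg (s : Tree₁ Unit) ≤ n by omega, t,
        show deg (t : Tree₁ Unit) ≤ n by omega, rfl⟩

theorem exists_deg_eq (n : ℕ) : ∃ t : FreeMagma Unit, deg (t : Tree₁ Unit) = n + 1 := by
  induction n with
  | zero => exact ⟨FreeMagma.of (), rfl⟩
  | succ n ih =>
    obtain ⟨t, ht⟩ := ih
    exact ⟨t * FreeMagma.of (), by rw [WithOne.coe_mul, deg_mul, ht, deg_of]⟩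

theorem exists_isGenTree_deg_eq (n : ℕ) : ∃ t, IsGenTree t ∧ deg t = n + 3 := by
  obtain ⟨t, ht⟩ := exists_deg_eq (n + 1)
  -- The leaf counts as ending in x (with empty left factor), so x * t is a generator tree whenever
  -- t has degree at least 2.
  refine ⟨leaf * t, ⟨FreeMagma.of (), t, rfl, fun h => ?_, Or.inl endsInVar_leaf⟩, ?_⟩
  · rw [h, deg_of] at ht
    omega
  · rw [deg_mul, ht, deg_of]
    omega

theorem IsGenTree.three_le_deg {t : Tree₁ Unit} (h : IsGenTree t) : 3 ≤ deg t := by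
  obtain ⟨s, r, rfl, hr, -⟩ := h
  have hs := deg_coe_pos s
  have h2 : ¬ deg (r : Tree₁ Unit) ≤ 1 := fun h => by
    rcases deg_le_one h with h | ⟨x, h⟩
    · exact WithOne.coe_ne_one h
    · exact hr h
  rw [deg_mul]
  omega

theorem exists_gradedFreeGenSeq (K : Type*) [Field K] [CharZero K] :
    ∃ (y : ℕ → MagAlg K Unit) (d : ℕ → ℕ), IsGradedFreeGenSeq y d ∧ d 0 = 3 := by
  have hfin : ∀ n, {a : {t // IsGenTree t} | deg a.1 ≤ n}.Finite := fun n =>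
    (finite_deg_le n).preimage Subtype.val_injective.injOn
  have : Countable (Tree₁ Unit) := by
    refine Set.countable_univ_iff.1 ((Set.countable_iUnion fun n => (finite_deg_le n).countable).mono
      fun t _ => Set.mem_iUnion.2 ⟨deg t, le_refl (deg t)⟩)
  have : Infinite {t // IsGenTree t} := by
    refine Infinite.of_surjective (fun a : {t // IsGenTree t} => deg a.1 - 3) fun n => ?_
    obtain ⟨t, ht, hn⟩ := exists_isGenTree_deg_eq n
    exact ⟨⟨t, ht⟩, by simp [hn]⟩
  obtain ⟨e, he⟩ := exists_equiv_nat_monotone (fun a : {t // IsGenTree t} => deg a.1) hfin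
  refine ⟨fun i => constProj K (mon K (e i).1), fun i => deg (e i).1,
    ⟨lift_constProj_injective (gen := fun i => (e i).1)
      (Subtype.val_injective.comp e.injective) fun i => (e i).2,
    range_lift_constProj (gen := fun i => (e i).1) fun t => ⟨fun h => ⟨e.symm ⟨t, h⟩, by simp⟩, ?_⟩,
    fun i => constProj_mon_isHomogeneous _, he⟩, le_antisymm ?_ (e 0).2.three_le_deg⟩
  · rintro ⟨i, rfl⟩
    exact (e i).2
  · obtain ⟨t, ht, hn⟩ := exists_isGenTree_deg_eq 0
    have := he (Nat.zero_le (e.symm ⟨t, ht⟩))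
    simpa [hn] using this

end Enumeration

end MagAlg

theorem mainTheorem2 (K : Type*) [Field K] [CharZero K] :
    (∃ (y : ℕ → MagAlg K Unit) (d : ℕ → ℕ), MagAlg.IsGradedFreeGenSeq y d ∧ d 0 = 3) ∧
    (∀ (y : ℕ → MagAlg K Unit) (d : ℕ → ℕ), MagAlg.IsGradedFreeGenSeq y d →
      (∃! Δ' : MagAlg K ℕ →ₙₐ[K] TensorProduct K (MagAlg K ℕ) (MagAlg K ℕ),
        MagAlg.IsRestrictedCoadd y Δ') ∧
      ∀ Δ' : MagAlg K ℕ →ₙₐ[K] TensorProduct K (MagAlg K ℕ) (MagAlg K ℕ),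
        MagAlg.IsRestrictedCoadd y Δ' →
        ∃ φ : MagAlg K ℕ ≃ₗ[K] MagAlg K ℕ,
          φ 1 = 1 ∧ (∀ f g, φ (f * g) = φ f * φ g) ∧
          MagAlg.IsStrict φ.toLinearMap ∧
          ∀ f, MagAlg.coadd K ℕ f =
            TensorProduct.map φ.toLinearMap φ.toLinearMap (Δ' (φ.symm f))) ∧
    (∃ (z : ℕ → MagAlg K Unit) (d : ℕ → ℕ), MagAlg.IsGradedFreeGenSeq z d ∧ d 0 = 3 ∧
      ∀ i, MagAlg.IsPrimitive (z i)) := by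
  refine ⟨MagAlg.exists_gradedFreeGenSeq K, fun y d h =>
    ⟨MagAlg.existsUnique_isRestrictedCoadd h, fun Δ' hΔ' =>
      MagAlg.exists_strict_automorphism h hΔ'⟩, ?_⟩
  obtain ⟨y, d, h, hd⟩ := MagAlg.exists_gradedFreeGenSeq K
  obtain ⟨z, hz, hp⟩ := MagAlg.exists_primitive_gradedFreeGenSeq h
  exact ⟨z, d, hz, hd, hp⟩
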